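/- **Theorem 10.1.** Let $N\ge 1$. Let $U(N)$ be the group of $N\times N$ unitary matrices, $\sigma$ its Haar probability measure, $I$ the identity matrix, and $\|M\|=\bigl(\sum_{i,j}|m_{ij}|^2\bigr)^{1/2}$ the Hilbert--Schmidt norm. Let $H(N)$ be the real vector space of $N\times N$ complex Hermitian matrices, and let $\lambda$ be Lebesgue measure on $H(N)$, i.e. the image of Lebesgue measure on $\mathbb{R}^{N^2}$ under the map sending real parameters $(y_{jj})_{1\le j\le N}$, $(z_{jk})_{1\le j<k\le N}$, $(w_{jk})_{1\le j<k\le N}$ to the Hermitian matrix with diagonal entries $y_{jj}$ and entries $(z_{jk}+\mathrm{i}w_{jk})/\sqrt2$ at $(j,k)$ for $j<k$ (this map is isometric from the Euclidean to the Hilbert--Schmidt norm). For $r>0$ put $$B(I,r)=\{V\in U(N):\|I-V\|\le r\},\qquad b(0,r)=\{G\in H(N):\|G\|\le r\},\qquad C_N=\frac{\prod_{j=1}^{N-1}j!}{(2\pi)^{N(N+1)/2}}.$$ There exists $r_0>0$, depending only on $N$, such that the following hold. 1. For every Borel measurable $f:U(N)\to[0,\infty)$ and every $0<r\le r_0$,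 $$(2-e^{6r})^{N^2}C_N\int_{b(0,r)}f(e^{\mathrm{i}H})\,d\lambda(H)\;\le\;\int_{B(I,2r)}f(U)\,d\sigma(U)\;\le\; e^{6rN^2}C_N\int_{b(0,3r)}f(e^{\mathrm{i}H})\,d\lambda(H).$$ 2. More generally, for every $n\ge1$, every Borel measurable $f:U(N)^n\to[0,\infty)$ and every $0<r\le r_0$ (with the same $r_0$), $$(2-e^{6r})^{N^2n}C_N^n\int_{b(0,r)^n}f(e^{\mathrm{i}H_1},\dots,e^{\mathrm{i}H_n})\,d\lambda(H_1)\cdots d\lambda(H_n)\le\int_{B(I,2r)^n}f(U_1,\dots,U_n)\,d\sigma(U_1)\cdots d\sigma(U_n)$$ $$\le e^{6rN^2n}C_N^n\int_{b(0,3r)^n}f(e^{\mathrm{i}H_1},\dots,e^{\mathrm{i}H_n})\,d\lambda(H_1)\cdots d\lambda(H_n).$$ All integrals are integrals of nonnegative functions with values in $[0,\infty]$. -/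

import Mathlib

open MeasureTheory
open scoped NNReal ENNReal

noncomputable section

namespace LieIntegration

/-- The unitary group `U(N)`, with the topology inherited from the space of matrices. -/
abbrev UGroup (N : ℕ) : Type := Matrix.unitaryGroup (Fin N) ℂ

/-- The real vector space `H(N)` of `N × N` complex Hermitian matrices. -/
abbrev Herm (N : ℕ) : Type := selfAdjoint (Matrix (Fin N) (Fin N) ℂ)

instance (N : ℕ) : MeasurableSpace (UGroup N) := borel _

instance (N : ℕ) : BorelSpace (UGroup N) := ⟨rfl⟩

instance (N : ℕ) : MeasurableSpace (Herm N) := borel _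

instance (N : ℕ) : BorelSpace (Herm N) := ⟨rfl⟩

instance (N : ℕ) : CompactSpace (UGroup N) := by
  refine isCompact_iff_compactSpace.mp ?_
  have hK : IsCompact (Set.univ.pi fun _ : Fin N => Set.univ.pi fun _ : Fin N =>
      Metric.closedBall (0 : ℂ) 1) :=
    isCompact_univ_pi fun _ => isCompact_univ_pi fun _ => isCompact_closedBall _ _
  refine IsCompact.of_isClosed_subset (X := Matrix (Fin N) (Fin N) ℂ) hK ?_ ?_
  · have h : ((Matrix.unitaryGroup (Fin N) ℂ : Submonoid _) : Set (Matrix (Fin N) (Fin N) ℂ))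
        = {U | U * star U = 1} := by
      ext U
      exact Matrix.mem_unitaryGroup_iff
    change IsClosed ((Matrix.unitaryGroup (Fin N) ℂ : Submonoid _) :
      Set (Matrix (Fin N) (Fin N) ℂ))
    rw [h]
    exact isClosed_eq (continuous_id.mul continuous_star) continuous_const
  · intro U hU i _ j _
    simpa using entry_norm_bound_of_unitary hU i j

/-- The Haar measure `σ` on `U(N)`, normalized to be a probability measure. -/
def haarU (N : ℕ) : Measure (UGroup N) := Measure.haarMeasure ⊤

open scoped Matrix.Norms.Frobenius in
/-- The Hilbert–Schmidt (Frobenius) norm of a complex matrix. -/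
def hsNorm {N : ℕ} (M : Matrix (Fin N) (Fin N) ℂ) : ℝ := ‖M‖

/-- The closed Hilbert–Schmidt ball `B(U, r)` in `U(N)`. -/
def ballU {N : ℕ} (U : UGroup N) (r : ℝ) : Set (UGroup N) :=
  {V | hsNorm (U.1 - V.1) ≤ r}

/-- The closed Hilbert–Schmidt ball `b(H, r)` in `H(N)`. -/
def ballH {N : ℕ} (H : Herm N) (r : ℝ) : Set (Herm N) :=
  {G | hsNorm (H.1 - G.1) ≤ r}

/-- The Hermitian matrix with real parameters `y j j`, and `z j k`, `w j k` for `j < k`.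
The `N²` parameters are stored in one array `x`: `y j j = x (j, j)` and, for `j < k`,
`z j k = x (j, k)` and `w j k = x (k, j)`. The entry at `(j, k)` with `j < k` is
`(z j k + i w j k) / √2`. -/
def hermOfCoords {N : ℕ} (x : Fin N × Fin N → ℝ) : Herm N :=
  ⟨Matrix.of fun j k =>
      if j = k then (x (j, j) : ℂ)
      else if j < k then ((x (j, k) : ℂ) + Complex.I * (x (k, j) : ℂ)) / (Real.sqrt 2 : ℂ)
      else ((x (k, j) : ℂ) - Complex.I * (x (j, k) : ℂ)) / (Real.sqrt 2 : ℂ), by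
    rw [selfAdjoint.mem_iff]
    ext j k
    rw [Matrix.star_apply, Matrix.of_apply, Matrix.of_apply]
    rcases lt_trichotomy j k with h | h | h
    · simp [h, h.ne, h.ne', h.not_gt, sub_eq_add_neg]
    · subst h; simp
    · simp [h, h.ne, h.ne', h.not_gt, sub_eq_add_neg]⟩

theorem continuous_hermOfCoords (N : ℕ) : Continuous (hermOfCoords (N := N)) := by
  refine Continuous.subtype_mk (continuous_matrix fun j k => ?_) _
  simp only [Matrix.of_apply]
  split_ifs <;> fun_prop

/-- Lebesgue measure `λ` on `H(N)`: the image of Lebesgue measure on `ℝ^(N²)` under the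
parametrization `hermOfCoords`, which is isometric for the Hilbert–Schmidt norm. -/
def lebesgueH (N : ℕ) : Measure (Herm N) :=
  (volume : Measure (Fin N × Fin N → ℝ)).map hermOfCoords

/-- The map `H ↦ e^{iH}` from `H(N)` to `U(N)`. -/
def expI {N : ℕ} (H : Herm N) : UGroup N :=
  ⟨NormedSpace.exp (Complex.I • (H : Matrix (Fin N) (Fin N) ℂ)), by
    rw [Matrix.mem_unitaryGroup_iff, Matrix.star_eq_conjTranspose, ← Matrix.exp_conjTranspose]
    have hH : (H : Matrix (Fin N) (Fin N) ℂ).conjTranspose = H := H.2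
    have h : (Complex.I • (H : Matrix (Fin N) (Fin N) ℂ)).conjTranspose
        = -(Complex.I • (H : Matrix (Fin N) (Fin N) ℂ)) := by
      rw [Matrix.conjTranspose_smul, hH]
      simp
    rw [h, ← Matrix.exp_add_of_commute _ _
      (Commute.refl (Complex.I • (H : Matrix (Fin N) (Fin N) ℂ))).neg_right]
    simp⟩

/-- The constant `C_N = (∏_{j=1}^{N-1} j!) / (2π)^{N(N+1)/2}`. -/
def constC (N : ℕ) : ℝ :=
  (∏ j ∈ Finset.Icc 1 (N - 1), (j.factorial : ℝ)) / (2 * Real.pi) ^ (N * (N + 1) / 2)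

end LieIntegration

end

open LieIntegration

open LieIntegration

noncomputable section

namespace LieIntegration

/-! ### Two-sided Lipschitz bounds for the exponential in a Banach algebra. -/

section Exponential

variable {𝔸 : Type*} [NormedRing 𝔸]

/-! Near `0` the map `H ↦ e^{iH}` almost preserves distances: on the ball of radius `ρ` it is
Lipschitz with constant `e^ρ` and shrinks distances at most by the factor `2 - e^ρ`, because `exp X
- exp Y` differs from `X - Y` by at most `(e^ρ - 1)‖X - Y‖`. The `N²`-dimensional Hausdorff measure
on `U(N)` is left invariant, finite and nonzero, hence a multiple of Haar measure; on Euclidean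
space it is a multiple of Lebesgue measure. So the Haar measure of the image of `A` lies between `(2
- e^ρ)^{N²} c λ(A)` and `e^{ρN²} c λ(A)` with one constant `c` (`exists_haarU_density`).

The value of `c` comes from computing one volume in two ways. Consider the matrices `T U` with `U ∈
C` and `T` lower triangular near the identity with real diagonal. Unitary invariance of Lebesgue
measure and Fubini make their volume `σ(C)` times the volume for `C = U(N)` (`volume_triSet`), and
Gram–Schmidt, row by row, gives the latter as a product of disc and shell volumes
(`volume_triFrames`). On the other hand `X + iH ↦ (1 + X)e^{iH}` has derivative the identity at `0`,
so for `C` the image of a small box the volume is asymptotically that of an explicit set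
(`volume_testBox`). Shrinking the box forces `c = C_N` (`density_eq_constC`).

The distance bounds also give `e^{i b(0,r)} ⊆ B(I,2r) ⊆ e^{i b(0,3r)}` for small `r`. Hence
restricted Haar measure is squeezed between multiples of push-forwards of Lebesgue measure
(`exists_haarU_restrict_bounds`). Integrating proves the case of one variable; monotonicity of
product measures (`measure_pi_mono`) proves the case of `n`. -/

theorem norm_pow_succ_sub_pow_succ_le {X Y : 𝔸} {ρ : ℝ} (hX : ‖X‖ ≤ ρ) (hY : ‖Y‖ ≤ ρ) (n : ℕ) :
    ‖X ^ (n + 1) - Y ^ (n + 1)‖ ≤ (n + 1) * ρ ^ n * ‖X - Y‖ := by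
  have hρ : 0 ≤ ρ := (norm_nonneg X).trans hX
  induction n with
  | zero => simp
  | succ n ih =>
    have h : X ^ (n + 1 + 1) - Y ^ (n + 1 + 1)
        = X * (X ^ (n + 1) - Y ^ (n + 1)) + (X - Y) * Y ^ (n + 1) := by
      rw [pow_succ' X (n + 1), pow_succ' Y (n + 1)]; noncomm_ring
    have hYn : ‖Y ^ (n + 1)‖ ≤ ρ ^ (n + 1) :=
      (norm_pow_le' Y n.succ_pos).trans (pow_le_pow_left₀ (norm_nonneg _) hY _)
    calc ‖X ^ (n + 1 + 1) - Y ^ (n + 1 + 1)‖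
        ≤ ‖X‖ * ‖X ^ (n + 1) - Y ^ (n + 1)‖ + ‖X - Y‖ * ‖Y ^ (n + 1)‖ := by
          rw [h]
          exact (norm_add_le _ _).trans (add_le_add (norm_mul_le _ _) (norm_mul_le _ _))
      _ ≤ ρ * ((n + 1) * ρ ^ n * ‖X - Y‖) + ‖X - Y‖ * ρ ^ (n + 1) := by gcongr
      _ = ((n + 1 : ℕ) + 1) * ρ ^ (n + 1) * ‖X - Y‖ := by push_cast; ring

/-- Once the constant and linear terms are removed, the term of degree `n + 2` is at most
`ρ^(n+1)/(n+1)! · ‖X - Y‖` by telescoping, and these bounds sum to `(e^ρ - 1)‖X - Y‖`. Both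
Lipschitz bounds follow by the triangle inequality. -/
theorem norm_exp_sub_exp_sub_le [NormedAlgebra ℝ 𝔸] [CompleteSpace 𝔸] {X Y : 𝔸} {ρ : ℝ}
    (hX : ‖X‖ ≤ ρ) (hY : ‖Y‖ ≤ ρ) :
    ‖NormedSpace.exp X - NormedSpace.exp Y - (X - Y)‖ ≤ (Real.exp ρ - 1) * ‖X - Y‖ := by
  have h1 : HasSum (fun n : ℕ => ((n.factorial : ℝ)⁻¹) • X ^ n - ((n.factorial : ℝ)⁻¹) • Y ^ n)
      (NormedSpace.exp X - NormedSpace.exp Y) :=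
    (NormedSpace.exp_series_hasSum_exp' (𝕂 := ℝ) X).sub
      (NormedSpace.exp_series_hasSum_exp' (𝕂 := ℝ) Y)
  have h2 := (hasSum_nat_add_iff' 2).2 h1
  have h3 : HasSum (fun n : ℕ => ρ ^ n / n.factorial) (Real.exp ρ) := by
    rw [Real.exp_eq_exp_ℝ]; exact NormedSpace.expSeries_div_hasSum_exp ρ
  have h4 := ((hasSum_nat_add_iff' 1).2 h3).mul_right ‖X - Y‖
  simp only [Finset.sum_range_succ, Finset.sum_range_zero, Nat.factorial, pow_zero, pow_one,
    Nat.cast_one, inv_one, one_smul, sub_self, zero_add, mul_one, div_one] at h2 h4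
  refine h2.norm_le_of_bounded h4 fun n => ?_
  rw [← smul_sub, norm_smul, norm_inv, Real.norm_natCast]
  calc ((((n + 2).factorial : ℕ) : ℝ))⁻¹ * ‖X ^ (n + 2) - Y ^ (n + 2)‖
      ≤ ((((n + 2).factorial : ℕ) : ℝ))⁻¹ * (((n + 1 : ℕ) + 1) * ρ ^ (n + 1) * ‖X - Y‖) := by
        gcongr
        exact norm_pow_succ_sub_pow_succ_le hX hY (n + 1)
    _ = ρ ^ (n + 1) / ((n + 1).factorial : ℕ) * ‖X - Y‖ := by
        rw [Nat.factorial_succ (n + 1)]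
        push_cast
        field_simp

theorem norm_exp_sub_exp_le [NormedAlgebra ℝ 𝔸] [CompleteSpace 𝔸] {X Y : 𝔸} {ρ : ℝ}
    (hX : ‖X‖ ≤ ρ) (hY : ‖Y‖ ≤ ρ) :
    ‖NormedSpace.exp X - NormedSpace.exp Y‖ ≤ Real.exp ρ * ‖X - Y‖ := by
  have h := norm_exp_sub_exp_sub_le hX hY
  have h' := norm_add_le (NormedSpace.exp X - NormedSpace.exp Y - (X - Y)) (X - Y)
  rw [sub_add_cancel] at h'
  linarith

theorem le_norm_exp_sub_exp [NormedAlgebra ℝ 𝔸] [CompleteSpace 𝔸] {X Y : 𝔸} {ρ : ℝ}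
    (hX : ‖X‖ ≤ ρ) (hY : ‖Y‖ ≤ ρ) :
    (2 - Real.exp ρ) * ‖X - Y‖ ≤ ‖NormedSpace.exp X - NormedSpace.exp Y‖ := by
  have h := norm_exp_sub_exp_sub_le hX hY
  have h' := norm_sub_norm_le (X - Y) (NormedSpace.exp X - NormedSpace.exp Y)
  rw [norm_sub_rev (X - Y) (_ - _)] at h'
  linarith

end Exponential

/-! ### Real coordinates on Hermitian matrices. -/

section Coordinates

variable {N : ℕ}

theorem hermOfCoords_sub (x y : Fin N × Fin N → ℝ) :
    (hermOfCoords (x - y)).1 = (hermOfCoords x).1 - (hermOfCoords y).1 := by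
  ext j k
  simp only [hermOfCoords, Matrix.of_apply, Matrix.sub_apply, Pi.sub_apply]
  split_ifs <;> push_cast <;> ring

theorem hermOfCoords_zero : (hermOfCoords (0 : Fin N × Fin N → ℝ)).1 = 0 := by
  simpa using hermOfCoords_sub (0 : Fin N × Fin N → ℝ) 0

theorem hermOfCoords_surjective : Function.Surjective (hermOfCoords (N := N)) := by
  intro H
  refine ⟨fun p => if p.1 = p.2 then (H.1 p.1 p.1).re
    else if p.1 < p.2 then Real.sqrt 2 * (H.1 p.1 p.2).re
    else Real.sqrt 2 * (H.1 p.2 p.1).im, ?_⟩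
  have h2 : ((Real.sqrt 2 : ℝ) : ℂ) ≠ 0 := by
    exact_mod_cast (Real.sqrt_pos.2 two_pos).ne'
  have hH : ∀ j k, star (H.1 k j) = H.1 j k := fun j k => by
    have := congrFun (congrFun H.2 j) k
    simpa [Matrix.star_apply] using this
  apply Subtype.ext
  ext j k
  simp only [hermOfCoords, Matrix.of_apply]
  rcases lt_trichotomy j k with h | h | h
  · simp only [h.ne, h.ne', h, h.not_gt, if_false, if_true]
    apply Complex.ext <;> simp [field]
  · subst h
    have := hH j j
    simp only [if_true]
    rw [← Complex.conj_eq_iff_re.1 this]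
    simp
  · simp only [h.ne, h.ne', h, h.not_gt, if_false, if_true]
    rw [← hH j k]
    apply Complex.ext <;> simp [field]

open scoped Matrix.Norms.Frobenius in
theorem norm_hermOfCoords (x : Fin N × Fin N → ℝ) :
    ‖(hermOfCoords x).1‖ = ‖WithLp.toLp 2 x‖ := by
  have h : ∀ j k : Fin N, ‖(hermOfCoords x).1 j k‖ ^ 2
      = if j = k then x (j, j) ^ 2 else (x (j, k) ^ 2 + x (k, j) ^ 2) / 2 := by
    intro j k
    simp only [hermOfCoords, Matrix.of_apply]
    have h2 : Real.sqrt 2 ^ 2 = 2 := Real.sq_sqrt two_pos.le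
    split_ifs with h1 h3
    · simp
    · rw [norm_div, div_pow, Complex.sq_norm, Complex.normSq_apply, Complex.norm_real,
        Real.norm_eq_abs, sq_abs, h2]
      simp; ring
    · rw [norm_div, div_pow, Complex.sq_norm, Complex.normSq_apply, Complex.norm_real,
        Real.norm_eq_abs, sq_abs, h2]
      simp; ring
  have hsum : ∑ j, ∑ k, ‖(hermOfCoords x).1 j k‖ ^ 2 = ∑ j, ∑ k, x (j, k) ^ 2 := by
    -- The averaged formula also holds on the diagonal, so the sum symmetrizes without cases.
    have h' : ∀ j k : Fin N, ‖(hermOfCoords x).1 j k‖ ^ 2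
        = (x (j, k) ^ 2 + x (k, j) ^ 2) / 2 := by
      intro j k
      rw [h]
      split_ifs with hjk
      · subst hjk; ring
      · rfl
    have hc : ∑ j, ∑ k, x (k, j) ^ 2 = ∑ j, ∑ k, x (j, k) ^ 2 := Finset.sum_comm
    simp only [h', ← Finset.sum_div, Finset.sum_add_distrib, hc]
    ring
  rw [Matrix.frobenius_norm_def, EuclideanSpace.norm_eq, Real.sqrt_eq_rpow, Fintype.sum_prod_type]
  simp only [Real.rpow_two, Real.norm_eq_abs, sq_abs]
  rw [hsum]

end Coordinates

/-! ### The exponential chart near the identity of `U(N)`. -/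

section ExpChart

variable {N : ℕ}

/-- The exponential chart `x ↦ e^{iH(x)}` in real coordinates. -/
def expChart (x : Fin N × Fin N → ℝ) : UGroup N := expI (hermOfCoords x)

instance : SecondCountableTopology (UGroup N) :=
  have : SecondCountableTopology (Matrix (Fin N) (Fin N) ℂ) :=
    inferInstanceAs (SecondCountableTopology (Fin N → Fin N → ℂ))
  TopologicalSpace.Subtype.secondCountableTopology _

theorem continuous_expI : Continuous (expI (N := N)) := by
  refine Continuous.subtype_mk ?_ _
  open scoped Matrix.Norms.Frobenius in
  exact (NormedSpace.exp_continuous (𝔸 := Matrix (Fin N) (Fin N) ℂ)).comp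
    (continuous_subtype_val.const_smul Complex.I)

theorem continuous_expChart : Continuous (expChart (N := N)) :=
  continuous_expI.comp (continuous_hermOfCoords N)

open scoped Matrix.Norms.Frobenius

theorem norm_I_smul_hermOfCoords (x : Fin N × Fin N → ℝ) :
    ‖Complex.I • (hermOfCoords x).1‖ = ‖WithLp.toLp 2 x‖ := by
  rw [norm_smul, Complex.norm_I, one_mul, norm_hermOfCoords]

theorem norm_I_smul_hermOfCoords_sub (x y : Fin N × Fin N → ℝ) :
    ‖Complex.I • (hermOfCoords x).1 - Complex.I • (hermOfCoords y).1‖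
      = ‖WithLp.toLp 2 x - WithLp.toLp 2 y‖ := by
  rw [← smul_sub, ← hermOfCoords_sub, norm_I_smul_hermOfCoords, WithLp.toLp_sub]

theorem expChart_zero : expChart (0 : Fin N × Fin N → ℝ) = 1 := by
  apply Subtype.ext
  change NormedSpace.exp (Complex.I • (hermOfCoords 0).1) = 1
  rw [hermOfCoords_zero, smul_zero, NormedSpace.exp_zero]

theorem norm_expChart_sub_le {x y : Fin N × Fin N → ℝ} {ρ : ℝ} (hx : ‖WithLp.toLp 2 x‖ ≤ ρ)
    (hy : ‖WithLp.toLp 2 y‖ ≤ ρ) :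
    ‖(expChart x).1 - (expChart y).1‖ ≤ Real.exp ρ * ‖WithLp.toLp 2 x - WithLp.toLp 2 y‖ := by
  rw [← norm_I_smul_hermOfCoords] at hx hy
  rw [← norm_I_smul_hermOfCoords_sub]
  exact norm_exp_sub_exp_le hx hy

theorem le_norm_expChart_sub {x y : Fin N × Fin N → ℝ} {ρ : ℝ} (hx : ‖WithLp.toLp 2 x‖ ≤ ρ)
    (hy : ‖WithLp.toLp 2 y‖ ≤ ρ) :
    (2 - Real.exp ρ) * ‖WithLp.toLp 2 x - WithLp.toLp 2 y‖ ≤ ‖(expChart x).1 - (expChart y).1‖ := by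
  rw [← norm_I_smul_hermOfCoords] at hx hy
  rw [← norm_I_smul_hermOfCoords_sub]
  exact le_norm_exp_sub_exp hx hy

/-- This gives `2 - e^{1/4} > 2/3`, the bound that turns the radius `2r` in the group into `3r` in
coordinates. -/
theorem exp_quarter_lt : Real.exp (1 / 4) < 4 / 3 := by
  rw [← Real.lt_log_iff_exp_lt (by norm_num)]
  have : (1 - (4 / 3 : ℝ)⁻¹) < Real.log (4 / 3) := by
    have := Real.one_sub_inv_le_log_of_pos (show (0 : ℝ) < 4 / 3 by norm_num)
    refine lt_of_le_of_ne this fun h => ?_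
    have h1 := Real.add_one_lt_exp (show -(Real.log (4/3)) ≠ 0 from
      neg_ne_zero.2 (Real.log_pos (by norm_num)).ne')
    rw [Real.exp_neg, Real.exp_log (by norm_num), ← h] at h1
    norm_num at h1
  norm_num at this ⊢
  exact this

/-- The inverse function theorem gives a small matrix `X` with `e^X = U`. Both `X*` and `-X`
exponentiate to `U⁻¹`, and exp is injective on the ball of radius `1/4` by the lower Lipschitz
bound, so `X` is skew-Hermitian. -/
theorem exists_ball_subset_expChart (N : ℕ) : ∃ η : ℝ, 0 < η ∧ ∀ U : UGroup N, ‖1 - U.1‖ < η →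
    ∃ x : Fin N × Fin N → ℝ, ‖WithLp.toLp 2 x‖ ≤ 1 / 4 ∧ expChart x = U := by
  have hs : HasStrictFDerivAt (NormedSpace.exp : Matrix (Fin N) (Fin N) ℂ → _)
      ((ContinuousLinearEquiv.refl ℂ (Matrix (Fin N) (Fin N) ℂ) :
        Matrix (Fin N) (Fin N) ℂ →L[ℂ] Matrix (Fin N) (Fin N) ℂ)) 0 :=
    hasStrictFDerivAt_exp_zero
  have hmem := Filter.image_mem_map (m := (NormedSpace.exp : Matrix (Fin N) (Fin N) ℂ → _))
    (Metric.ball_mem_nhds (0 : Matrix (Fin N) (Fin N) ℂ) (show (0 : ℝ) < 1 / 4 by norm_num))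
  rw [hs.map_nhds_eq_of_equiv, NormedSpace.exp_zero] at hmem
  obtain ⟨η, hη, hsub⟩ := Metric.mem_nhds_iff.1 hmem
  refine ⟨η, hη, fun U hU => ?_⟩
  obtain ⟨X, hX, hXU⟩ := hsub (show U.1 ∈ Metric.ball 1 η by
    rw [mem_ball_iff_norm, norm_sub_rev]; exact hU)
  rw [mem_ball_zero_iff] at hX
  have hX' : ‖X.conjTranspose‖ ≤ 1 / 4 := by
    rw [Matrix.frobenius_norm_conjTranspose]; exact hX.le
  have hexp : NormedSpace.exp X.conjTranspose = NormedSpace.exp (-X) := by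
    rw [Matrix.exp_conjTranspose, Matrix.exp_neg, hXU]
    symm
    apply Matrix.inv_eq_left_inv
    have := Matrix.mem_unitaryGroup_iff'.1 U.2
    rwa [Matrix.star_eq_conjTranspose] at this
  have hskew : X.conjTranspose = -X := by
    have h := le_norm_exp_sub_exp (𝔸 := Matrix (Fin N) (Fin N) ℂ) hX'
      ((norm_neg X).le.trans hX.le)
    replace h := h.trans (norm_le_zero_iff.2 (sub_eq_zero.2 hexp))
    have h4 := exp_quarter_lt
    have : ‖X.conjTranspose - -X‖ ≤ 0 := by
      by_contra hc
      push Not at hc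
      nlinarith
    exact sub_eq_zero.1 (norm_le_zero_iff.1 this)
  have hherm : (-Complex.I) • X ∈ selfAdjoint (Matrix (Fin N) (Fin N) ℂ) := by
    rw [selfAdjoint.mem_iff, Matrix.star_eq_conjTranspose, Matrix.conjTranspose_smul, hskew]
    simp
  obtain ⟨x, hx⟩ := hermOfCoords_surjective ⟨_, hherm⟩
  have hIx : Complex.I • (hermOfCoords x).1 = X := by
    rw [hx]; simp [smul_smul]
  refine ⟨x, ?_, Subtype.ext ?_⟩
  · rw [← norm_I_smul_hermOfCoords, hIx]; exact hX.le
  · rw [← hXU, ← hIx]; rfl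

theorem exists_ballU_subset_expChart (N : ℕ) : ∃ η : ℝ, 0 < η ∧ ∀ r : ℝ, r ≤ η →
    ∀ U ∈ ballU (1 : UGroup N) (2 * r),
      ∃ x : Fin N × Fin N → ℝ, ‖WithLp.toLp 2 x‖ ≤ 3 * r ∧ expChart x = U := by
  obtain ⟨η, hη, h⟩ := exists_ball_subset_expChart N
  -- With `r ≤ η/4` the distance `2r` stays strictly below `η`.
  refine ⟨η / 4, by positivity, fun r hr U hU => ?_⟩
  have hU' : ‖1 - U.1‖ ≤ 2 * r := hU
  obtain ⟨x, hx, rfl⟩ := h U (hU'.trans_lt (by linarith))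
  refine ⟨x, ?_, rfl⟩
  have h1 := le_norm_expChart_sub (x := 0) (y := x) (ρ := 1 / 4) (by simp) hx
  rw [expChart_zero, WithLp.toLp_zero, zero_sub, norm_neg] at h1
  have h2 : ‖(1 : UGroup N).1 - (expChart x).1‖ ≤ 2 * r := hU'
  nlinarith [exp_quarter_lt, norm_nonneg (WithLp.toLp 2 x)]

theorem expChart_mem_ballU {x : Fin N × Fin N → ℝ} {r : ℝ} (hr : r ≤ 1 / 4)
    (hx : ‖WithLp.toLp 2 x‖ ≤ r) : expChart x ∈ ballU (1 : UGroup N) (2 * r) := by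
  have hr0 : 0 ≤ r := (norm_nonneg _).trans hx
  have h1 := norm_expChart_sub_le (x := 0) (y := x) (by simpa using hr0) hx
  rw [expChart_zero, WithLp.toLp_zero, zero_sub, norm_neg] at h1
  have h2 : Real.exp r ≤ 2 := by
    have := exp_quarter_lt
    have := Real.exp_le_exp.2 hr
    linarith
  exact h1.trans (mul_le_mul h2 hx (norm_nonneg _) (by norm_num))

end ExpChart

/-! ### Haar measure as a multiple of Hausdorff measure, and its density in the chart. -/

section Hausdorff

theorem le_hausdorffMeasure_image_of_antilipschitzOn {X Y : Type*} [EMetricSpace X] [EMetricSpace Y]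
    [MeasurableSpace X] [BorelSpace X] [MeasurableSpace Y] [BorelSpace Y] {f : X → Y} {s : Set X}
    {K : ℝ≥0} (hf : ∀ x ∈ s, ∀ y ∈ s, edist x y ≤ K * edist (f x) (f y)) {d : ℝ} (hd : 0 ≤ d) :
    μH[d] s ≤ (K : ℝ≥0∞) ^ d * μH[d] (f '' s) := by
  have h : AntilipschitzWith K (fun x : s => f x) := fun x y => hf x x.2 y y.2
  have h1 := h.le_hausdorffMeasure_image hd Set.univ
  have h2 := (isometry_subtype_coe (s := s)).hausdorffMeasure_image (Or.inl hd) Set.univ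
  rw [Set.image_univ, Subtype.range_coe] at h2
  rw [h2]
  convert h1 using 3
  rw [Set.image_univ, Set.image_eq_range]

open scoped Matrix.Norms.Frobenius

variable {N : ℕ}

instance : @BorelSpace (UGroup N) (Subtype.metricSpace
    (α := Matrix (Fin N) (Fin N) ℂ)).toPseudoMetricSpace.toUniformSpace.toTopologicalSpace _ := ⟨rfl⟩

theorem dist_eq_norm_coe_sub (U V : UGroup N) : dist U V = ‖U.1 - V.1‖ := by
  rw [Subtype.dist_eq, dist_eq_norm]

theorem norm_unitary_mul (U : UGroup N) (M : Matrix (Fin N) (Fin N) ℂ) : ‖U.1 * M‖ = ‖M‖ := by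
  have key : ∀ A : Matrix (Fin N) (Fin N) ℂ, ((‖A‖ ^ 2 : ℝ) : ℂ) = (star A * A).trace := by
    intro A
    rw [Matrix.frobenius_norm_def, ← Real.sqrt_eq_rpow, Real.sq_sqrt (by positivity)]
    simp only [Real.rpow_two, Matrix.trace, Matrix.diag, Matrix.mul_apply, Matrix.star_apply]
    rw [Finset.sum_comm]
    push_cast
    refine Finset.sum_congr rfl fun i _ => Finset.sum_congr rfl fun j _ => ?_
    rw [← Complex.conj_mul']; rfl
  have h : ((‖U.1 * M‖ ^ 2 : ℝ) : ℂ) = ((‖M‖ ^ 2 : ℝ) : ℂ) := by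
    rw [key, key, star_mul, mul_assoc, ← mul_assoc (star U.1), Matrix.mem_unitaryGroup_iff'.1 U.2,
      one_mul]
  exact (sq_eq_sq₀ (norm_nonneg _) (norm_nonneg _)).1 (Complex.ofReal_injective h)

/-- Left translations being isometries, Hausdorff measure on `U(N)` is left invariant. -/
instance : IsIsometricSMul (UGroup N) (UGroup N) := ⟨fun U => Isometry.of_dist_eq fun V W => by
  rw [dist_eq_norm_coe_sub, dist_eq_norm_coe_sub]
  change ‖U.1 * V.1 - U.1 * W.1‖ = _
  rw [← mul_sub, norm_unitary_mul]⟩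

/-- Both measures are additive Haar measures on Euclidean space. The value of the ratio `k` is never
needed: it is absorbed into the density constant, found later by other means. -/
theorem hausdorffMeasure_toLp_image (ι : Type*) [Fintype ι] : ∃ k : ℝ≥0∞, k ≠ 0 ∧ k ≠ ⊤ ∧
    ∀ A : Set (ι → ℝ), μH[Fintype.card ι] (WithLp.toLp 2 '' A : Set (EuclideanSpace ℝ ι))
      = k * volume A := by
  have hh : (μH[Fintype.card ι] : Measure (EuclideanSpace ℝ ι)).IsAddHaarMeasure := by
    have := isAddHaarMeasure_hausdorffMeasure (E := EuclideanSpace ℝ ι)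
    rwa [finrank_euclideanSpace] at this
  have hk := Measure.isAddLeftInvariant_eq_smul
    (μH[Fintype.card ι] : Measure (EuclideanSpace ℝ ι)) volume
  have hk0 := Measure.addHaarScalarFactor_pos_of_isAddHaarMeasure
    (μH[Fintype.card ι] : Measure (EuclideanSpace ℝ ι)) volume
  refine ⟨_, ENNReal.coe_ne_zero.2 hk0.ne', ENNReal.coe_ne_top, fun A => ?_⟩
  conv_lhs => rw [hk]
  rw [Measure.smul_apply, ENNReal.smul_def, smul_eq_mul]
  congr 1
  have h := (EuclideanSpace.volume_preserving_symm_measurableEquiv_toLp ι).symm.measure_preimage_equiv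
    (WithLp.toLp 2 '' A : Set (EuclideanSpace ℝ ι))
  rw [← h]
  congr 1
  ext x
  constructor
  · rintro ⟨y, hy, hyx⟩
    have : y = x := congrArg WithLp.ofLp hyx
    rwa [← this]
  · intro hx
    exact ⟨x, hx, rfl⟩

theorem hausdorffMeasure_image_expChart_le {A : Set (Fin N × Fin N → ℝ)} {ρ : ℝ}
    (hA : ∀ x ∈ A, ‖WithLp.toLp 2 x‖ ≤ ρ) {d : ℝ} (hd : 0 ≤ d) :
    (μH[d] : Measure (UGroup N)) (expChart '' A)
      ≤ ENNReal.ofReal (Real.exp ρ) ^ d *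
        μH[d] (WithLp.toLp 2 '' A : Set (EuclideanSpace ℝ (Fin N × Fin N))) := by
  have hl : LipschitzOnWith (Real.exp ρ).toNNReal
      (fun y : EuclideanSpace ℝ (Fin N × Fin N) => expChart (WithLp.ofLp y))
      (WithLp.toLp 2 '' A) := by
    apply LipschitzOnWith.of_dist_le_mul
    rintro _ ⟨x, hx, rfl⟩ _ ⟨y, hy, rfl⟩
    rw [dist_eq_norm_coe_sub, dist_eq_norm, Real.coe_toNNReal _ (Real.exp_pos _).le]
    exact norm_expChart_sub_le (hA x hx) (hA y hy)
  have h := hl.hausdorffMeasure_image_le hd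
  rwa [Set.image_image] at h

theorem le_hausdorffMeasure_image_expChart {A : Set (Fin N × Fin N → ℝ)} {ρ : ℝ}
    (hρ : Real.exp ρ < 2) (hA : ∀ x ∈ A, ‖WithLp.toLp 2 x‖ ≤ ρ) {d : ℝ} (hd : 0 ≤ d) :
    ENNReal.ofReal (2 - Real.exp ρ) ^ d *
        μH[d] (WithLp.toLp 2 '' A : Set (EuclideanSpace ℝ (Fin N × Fin N)))
      ≤ (μH[d] : Measure (UGroup N)) (expChart '' A) := by
  have hpos : 0 < 2 - Real.exp ρ := by linarith
  have h := le_hausdorffMeasure_image_of_antilipschitzOn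
    (f := fun y : EuclideanSpace ℝ (Fin N × Fin N) => expChart (WithLp.ofLp y))
    (s := WithLp.toLp 2 '' A) (K := ((2 - Real.exp ρ)⁻¹).toNNReal) ?_ hd
  · rw [Set.image_image] at h
    change _ ≤ ENNReal.ofReal _ ^ d * _ at h
    rw [ENNReal.ofReal_inv_of_pos hpos, ENNReal.inv_rpow] at h
    have h0 : ENNReal.ofReal (2 - Real.exp ρ) ^ d ≠ 0 := by
      simp only [ne_eq, ENNReal.rpow_eq_zero_iff, ENNReal.ofReal_eq_zero, not_le.2 hpos, false_and,
        ENNReal.ofReal_ne_top, or_self, not_false_iff]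
    have ht : ENNReal.ofReal (2 - Real.exp ρ) ^ d ≠ ⊤ :=
      ENNReal.rpow_ne_top_of_nonneg hd ENNReal.ofReal_ne_top
    rw [mul_comm, ← ENNReal.le_div_iff_mul_le (Or.inl h0) (Or.inl ht), div_eq_mul_inv, mul_comm]
    exact h
  · rintro _ ⟨x, hx, rfl⟩ _ ⟨y, hy, rfl⟩
    rw [edist_dist, edist_dist, dist_eq_norm_coe_sub, dist_eq_norm]
    change _ ≤ ENNReal.ofReal _ * _
    rw [← ENNReal.ofReal_mul (by positivity)]
    apply ENNReal.ofReal_le_ofReal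
    rw [inv_mul_eq_div, le_div_iff₀ hpos, mul_comm]
    exact le_norm_expChart_sub (hA x hx) (hA y hy)

theorem image_expChart_mem_nhds :
    expChart '' {x : Fin N × Fin N → ℝ | ‖WithLp.toLp 2 x‖ ≤ 1 / 4} ∈ nhds (1 : UGroup N) := by
  obtain ⟨η, hη, h⟩ := exists_ball_subset_expChart N
  refine Filter.mem_of_superset (Metric.ball_mem_nhds (1 : UGroup N) hη) fun U hU => ?_
  rw [Metric.mem_ball, dist_comm, dist_eq_norm_coe_sub] at hU
  obtain ⟨x, hx, rfl⟩ := h U hU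
  exact ⟨x, hx, rfl⟩

theorem exp_quarter_lt_two : Real.exp (1 / 4) < 2 := exp_quarter_lt.trans (by norm_num)

theorem setOf_norm_toLp_le (ι : Type*) [Fintype ι] (ρ : ℝ) :
    WithLp.toLp 2 '' {x : ι → ℝ | ‖WithLp.toLp 2 x‖ ≤ ρ}
      = Metric.closedBall (0 : EuclideanSpace ℝ ι) ρ := by
  ext y
  rw [mem_closedBall_zero_iff]
  constructor
  · rintro ⟨x, hx, rfl⟩
    exact hx
  · intro hy
    exact ⟨WithLp.ofLp y, hy, rfl⟩

/-- On small balls the exponential chart distorts volumes by a constant, up to an explicit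
factor close to one. -/
theorem exists_haarU_density (N : ℕ) : ∃ c : ℝ≥0∞, c ≠ 0 ∧ c ≠ ⊤ ∧
    ∀ (A : Set (Fin N × Fin N → ℝ)) (ρ : ℝ), ρ ≤ 1 / 4 → (∀ x ∈ A, ‖WithLp.toLp 2 x‖ ≤ ρ) →
      ENNReal.ofReal (2 - Real.exp ρ) ^ (N ^ 2) * c * volume A ≤ haarU N (expChart '' A) ∧
      haarU N (expChart '' A) ≤ ENNReal.ofReal (Real.exp ρ) ^ (N ^ 2) * c * volume A := by
  obtain ⟨k, hk0, hkt, hk⟩ := hausdorffMeasure_toLp_image (Fin N × Fin N)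
  have hd : (0 : ℝ) ≤ Fintype.card (Fin N × Fin N) := by positivity
  have hcard : ((Fintype.card (Fin N × Fin N) : ℕ)) = N ^ 2 := by simp [sq]
  set d : ℝ := ((Fintype.card (Fin N × Fin N) : ℕ) : ℝ) with hd_def
  set ν : Measure (UGroup N) := μH[d] with hν
  set b : Set (Fin N × Fin N → ℝ) := {x | ‖WithLp.toLp 2 x‖ ≤ 1 / 4} with hb
  have hup := fun (A : Set (Fin N × Fin N → ℝ)) ρ hA =>
    hausdorffMeasure_image_expChart_le (A := A) (ρ := ρ) hA hd
  have hlow := fun (A : Set (Fin N × Fin N → ℝ)) ρ hρ hA =>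
    le_hausdorffMeasure_image_expChart (A := A) (ρ := ρ) hρ hA hd
  have hkb : k * volume b = μH[d] (Metric.closedBall (0 : EuclideanSpace ℝ (Fin N × Fin N)) (1/4)) := by
    rw [← hk, hb, setOf_norm_toLp_le]
  have hh : (μH[d] : Measure (EuclideanSpace ℝ (Fin N × Fin N))).IsAddHaarMeasure := by
    have := isAddHaarMeasure_hausdorffMeasure (E := EuclideanSpace ℝ (Fin N × Fin N))
    rwa [finrank_euclideanSpace] at this
  -- By compactness it suffices that each `U` has a neighbourhood of finite measure; a translate of
  -- the chart image of a ball is one, by the upper Lipschitz bound.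
  have hfin : ν Set.univ < ⊤ := by
    have hc : IsCompact (Set.univ : Set (UGroup N)) := isCompact_univ
    refine hc.measure_lt_top_of_nhdsWithin fun U _ => ?_
    rw [nhdsWithin_univ]
    refine ⟨(fun V => U⁻¹ * V) ⁻¹' (expChart '' b), ?_, ?_⟩
    · refine (continuous_const_mul U⁻¹).continuousAt.preimage_mem_nhds ?_
      rw [inv_mul_cancel]
      exact image_expChart_mem_nhds
    · rw [measure_preimage_mul]
      refine (hup b _ fun x hx => hx).trans_lt (ENNReal.mul_lt_top ?_ ?_)
      · exact ENNReal.rpow_lt_top_of_nonneg hd ENNReal.ofReal_ne_top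
      · rw [hk, hkb]
        exact (isCompact_closedBall _ _).measure_lt_top
  have hpos : ν Set.univ ≠ 0 := by
    intro h0
    have h1 : ν (expChart '' b) = 0 := measure_mono_null (Set.subset_univ _) h0
    have h2 := hlow b _ exp_quarter_lt_two fun x hx => hx
    rw [show (μH[d] : Measure (UGroup N)) (expChart '' b) = 0 from h1, nonpos_iff_eq_zero,
      mul_eq_zero, ENNReal.rpow_eq_zero_iff, hk, hkb] at h2
    rcases h2 with h2 | h2
    · have := exp_quarter_lt_two
      rcases h2 with h2 | h2
      · rw [ENNReal.ofReal_eq_zero] at h2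
        linarith [h2.1]
      · exact ENNReal.ofReal_ne_top h2.1
    · exact (Metric.measure_closedBall_pos _ _ (by norm_num)).ne' h2
  have : IsFiniteMeasure ν := ⟨hfin⟩
  -- Uniqueness of Haar measure on the group, applied to the left-invariant finite measure `ν`.
  have hνσ : ν = ν Set.univ • haarU N := Measure.haarMeasure_unique ν ⊤
  have hσ : ∀ S, haarU N S = (ν Set.univ)⁻¹ * ν S := by
    intro S
    conv_rhs => rw [hνσ, Measure.smul_apply (ν Set.univ) (haarU N) S, smul_eq_mul, ← mul_assoc]
    rw [← hνσ, ENNReal.inv_mul_cancel hpos hfin.ne, one_mul]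
  refine ⟨(ν Set.univ)⁻¹ * k, mul_ne_zero (ENNReal.inv_ne_zero.2 hfin.ne) hk0,
    ENNReal.mul_ne_top (ENNReal.inv_ne_top.2 hpos) hkt, fun A ρ hρ hA => ?_⟩
  have hρ2 : Real.exp ρ < 2 := (Real.exp_le_exp.2 hρ).trans_lt exp_quarter_lt_two
  have h1 := hup A ρ hA
  have h2 := hlow A ρ hρ2 hA
  have hpow : ∀ a : ℝ≥0∞, a ^ d = a ^ N ^ 2 := fun a => by
    rw [hd_def, ENNReal.rpow_natCast, hcard]
  rw [hk, hpow] at h1 h2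
  rw [hσ]
  constructor
  · calc _ = (ν Set.univ)⁻¹ * (ENNReal.ofReal (2 - Real.exp ρ) ^ N ^ 2 * (k * volume A)) := by ring
      _ ≤ _ := by gcongr
  · calc _ ≤ (ν Set.univ)⁻¹ * (ENNReal.ofReal (Real.exp ρ) ^ N ^ 2 * (k * volume A)) := by gcongr
      _ = _ := by ring

end Hausdorff

/-! ### Unitary changes of coordinates and completion of orthonormal rows. -/

section UnitaryRows

open Matrix

variable {N : ℕ}

/-- The real determinant of a complex linear map is the squared modulus of its complex determinant,
here `1`. -/
theorem measurePreserving_vecMul (U : UGroup N) :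
    MeasurePreserving (fun x : Fin N → ℂ => x ᵥ* U.1) volume volume := by
  let f : (Fin N → ℂ) →ₗ[ℝ] (Fin N → ℂ) := (Matrix.toLin' U.1ᵀ).restrictScalars ℝ
  have hf : (f : (Fin N → ℂ) → Fin N → ℂ) = fun x => x ᵥ* U.1 := by
    funext x
    exact Matrix.mulVec_transpose U.1 x
  have hnorm : ‖U.1.det‖ = 1 := by
    have h := Matrix.det_of_mem_unitary U.2
    exact CStarRing.norm_of_mem_unitary h
  have hdet : LinearMap.det f = 1 := by
    rw [LinearMap.det_restrictScalars, LinearMap.det_toLin', Matrix.det_transpose,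
      Algebra.norm_complex_apply, Complex.normSq_eq_norm_sq, hnorm, one_pow]
  have h := Measure.map_linearMap_addHaar_eq_smul_addHaar
    (volume : Measure (Fin N → ℂ)) (f := f) (by rw [hdet]; exact one_ne_zero)
  rw [hdet, hf] at h
  refine ⟨?_, by simpa using h⟩
  rw [← hf]
  exact f.continuous_of_finiteDimensional.measurable

theorem unitary_mul_star (U : UGroup N) : U.1 * star U.1 = 1 := Matrix.mem_unitaryGroup_iff.1 U.2

theorem unitary_star_mul (U : UGroup N) : star U.1 * U.1 = 1 := Matrix.mem_unitaryGroup_iff'.1 U.2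

theorem vecMul_star_apply (x : Fin N → ℂ) (A : Matrix (Fin N) (Fin N) ℂ) (j : Fin N) :
    (x ᵥ* star A) j = x ⬝ᵥ star (A.row j) := rfl

theorem sum_normSq_eq_dotProduct (x : Fin N → ℂ) : ((∑ j, ‖x j‖ ^ 2 : ℝ) : ℂ) = x ⬝ᵥ star x := by
  push_cast
  refine Finset.sum_congr rfl fun j _ => ?_
  rw [← Complex.mul_conj']; rfl

theorem sum_normSq_vecMul_star (x : Fin N → ℂ) (U : UGroup N) :
    ∑ j, ‖(x ᵥ* star U.1) j‖ ^ 2 = ∑ j, ‖x j‖ ^ 2 := by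
  apply Complex.ofReal_injective
  rw [sum_normSq_eq_dotProduct, sum_normSq_eq_dotProduct, Matrix.star_vecMul,
    Matrix.star_eq_conjTranspose, Matrix.conjTranspose_conjTranspose,
    ← Matrix.dotProduct_mulVec, Matrix.mulVec_mulVec, ← Matrix.star_eq_conjTranspose,
    unitary_star_mul, Matrix.one_mulVec]

theorem vecMul_star_vecMul (x : Fin N → ℂ) (U : UGroup N) : (x ᵥ* star U.1) ᵥ* U.1 = x := by
  rw [Matrix.vecMul_vecMul, unitary_star_mul, Matrix.vecMul_one]

theorem unitary_dotProduct_star (U : UGroup N) (i j : Fin N) :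
    U.1.row i ⬝ᵥ star (U.1.row j) = if i = j then 1 else 0 := by
  have h := congrFun (congrFun (unitary_mul_star U) i) j
  rw [Matrix.one_apply] at h
  exact h

theorem exists_unitary_extend (U : UGroup N) (k : Fin N) {v : Fin N → ℂ} (hv : v ⬝ᵥ star v = 1)
    (horth : ∀ j < k, v ⬝ᵥ star (U.1.row j) = 0) :
    ∃ V : UGroup N, (∀ j < k, V.1.row j = U.1.row j) ∧ V.1.row k = v := by
  -- Only indices up to `k` enter the orthonormal family; the value `v` matters at index `k` alone.
  let w : Fin N → EuclideanSpace ℂ (Fin N) := fun j =>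
    if j < k then WithLp.toLp 2 (U.1.row j) else WithLp.toLp 2 v
  have hin : ∀ x y : Fin N → ℂ, inner ℂ (WithLp.toLp 2 x : EuclideanSpace ℂ (Fin N)) (WithLp.toLp 2 y)
      = y ⬝ᵥ star x := fun x y => EuclideanSpace.inner_toLp_toLp x y
  have horth' : ∀ j < k, U.1.row j ⬝ᵥ star v = 0 := fun j hj => by
    have := congrArg star (horth j hj)
    rwa [star_zero, ← Matrix.star_dotProduct_star, star_star] at this
  have hw : Orthonormal ℂ ((Set.Iic k).domRestrict w) := by
    rw [orthonormal_iff_ite]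
    rintro ⟨i, hi⟩ ⟨j, hj⟩
    change inner ℂ (w i) (w j) = _
    simp only [Subtype.mk.injEq, w]
    rcases lt_or_eq_of_le (Set.mem_Iic.1 hi) with hi' | rfl <;>
    rcases lt_or_eq_of_le (Set.mem_Iic.1 hj) with hj' | rfl
    · rw [if_pos hi', if_pos hj', hin, unitary_dotProduct_star]
      simp only [eq_comm]
    · rw [if_pos hi', if_neg (lt_irrefl _), hin, horth _ hi', if_neg hi'.ne]
    · rw [if_neg (lt_irrefl _), if_pos hj', hin, horth' _ hj', if_neg hj'.ne']
    · rw [if_neg (lt_irrefl _), hin, hv, if_pos rfl]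
  obtain ⟨b, hb⟩ := hw.exists_orthonormalBasis_extension_of_card_eq (by simp)
  have hunit : (Matrix.of fun i => WithLp.ofLp (b i)) ∈ Matrix.unitaryGroup (Fin N) ℂ := by
    rw [Matrix.mem_unitaryGroup_iff]
    ext i j
    have h := (orthonormal_iff_ite.1 b.orthonormal) j i
    rw [Matrix.one_apply]
    simp only [eq_comm (a := i)]
    rw [← h, EuclideanSpace.inner_eq_star_dotProduct]
    rfl
  refine ⟨⟨_, hunit⟩, fun j hj => ?_, ?_⟩
  · change WithLp.ofLp (b j) = _
    rw [hb j hj.le]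
    simp [w, hj]
  · change WithLp.ofLp (b k) = _
    rw [hb k (Set.mem_Iic.2 le_rfl)]
    simp [w]

end UnitaryRows

/-! ### Volume of a spherical shell in complex space. -/

section Shell

open Real in
theorem volume_shell (ι : Type*) [Fintype ι] [Nonempty ι] {ε : ℝ} (hε : 0 ≤ ε) :
    volume {x : ι → ℂ | ∑ i, ‖x i‖ ^ 2 ∈ Set.Icc 1 ((1 + ε) ^ 2)}
      = ENNReal.ofReal (((1 + ε) ^ (2 * Fintype.card ι) - 1) *
          (π ^ Fintype.card ι / (Fintype.card ι).factorial)) := by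
  have hG : (π * Real.Gamma (2 / 2 + 1)) ^ Fintype.card ι / Real.Gamma (2 * Fintype.card ι / 2 + 1)
      = π ^ Fintype.card ι / (Fintype.card ι).factorial := by
    rw [div_self two_ne_zero, show (1 : ℝ) + 1 = 2 by norm_num, Real.Gamma_two, mul_one,
      mul_div_cancel_left₀ _ (two_ne_zero), Real.Gamma_nat_eq_factorial]
  have hset : {x : ι → ℂ | ∑ i, ‖x i‖ ^ 2 ∈ Set.Icc 1 ((1 + ε) ^ 2)}
      = {x : ι → ℂ | (∑ i, ‖x i‖ ^ (2 : ℝ)) ^ (1 / 2 : ℝ) ≤ 1 + ε} \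
        {x : ι → ℂ | (∑ i, ‖x i‖ ^ (2 : ℝ)) ^ (1 / 2 : ℝ) < 1} := by
    ext x
    simp only [Set.mem_ofPred_eq, Set.mem_sdiff, Set.mem_Icc, ← Real.sqrt_eq_rpow, Real.rpow_two,
      not_lt, Real.one_le_sqrt, Real.sqrt_le_left (show 0 ≤ 1 + ε by linarith)]
    exact and_comm
  have hle := Complex.volume_sum_rpow_le ι (p := 2) one_le_two (1 + ε)
  have hlt := Complex.volume_sum_rpow_lt ι (p := 2) one_le_two 1
  rw [hG] at hle hlt
  rw [ENNReal.ofReal_one, one_pow, one_mul] at hlt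
  have hpos : 0 ≤ π ^ Fintype.card ι / (Fintype.card ι).factorial := by positivity
  have hm : MeasurableSet {x : ι → ℂ | (∑ i, ‖x i‖ ^ (2 : ℝ)) ^ (1 / 2 : ℝ) < 1} := by
    refine measurableSet_lt ?_ measurable_const
    fun_prop
  rw [hset, measure_sdiff ?_ hm.nullMeasurableSet (by rw [hlt]; exact ENNReal.ofReal_ne_top), hle, hlt,
    ← ENNReal.ofReal_pow (by linarith), ← ENNReal.ofReal_mul (by positivity),
    ← ENNReal.ofReal_sub _ hpos, sub_mul, one_mul]
  intro x hx
  simp only [Set.mem_ofPred_eq] at hx ⊢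
  linarith

end Shell

/-! ### The factorization of a matrix as lower triangular times unitary. -/

section TriangularRows

open Matrix

variable {N : ℕ}

/-- The entries at `(i, j)` of lower triangular matrices close to the identity. -/
def triEntry (ε : ℝ) (i j : Fin N) : Set ℂ :=
  if j < i then Metric.closedBall 0 ε else if j = i then Complex.ofReal '' Set.Icc 1 (1 + ε) else {0}

/-- The `i`-th rows of lower triangular matrices close to the identity. -/
def triRow (ε : ℝ) (i : Fin N) : Set (Fin N → ℂ) := {y | ∀ j, y j ∈ triEntry ε i j}

theorem isClosed_triEntry (ε : ℝ) (i j : Fin N) : IsClosed (triEntry ε i j) := by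
  unfold triEntry
  split_ifs
  · exact Metric.isClosed_closedBall
  · exact (isCompact_Icc.image Complex.continuous_ofReal).isClosed
  · exact isClosed_singleton

theorem isClosed_triRow (ε : ℝ) (i : Fin N) : IsClosed (triRow ε i) := by
  have : triRow ε i = ⋂ j, (fun y : Fin N → ℂ => y j) ⁻¹' triEntry ε i j := by
    ext y; simp [triRow]
  rw [this]
  exact isClosed_iInter fun j => (isClosed_triEntry ε i j).preimage (continuous_apply j)

theorem norm_le_of_mem_triRow {ε : ℝ} {i j : Fin N} {y : Fin N → ℂ} (hy : y ∈ triRow ε i)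
    (hj : j < i) : ‖y j‖ ≤ ε := by
  have := hy j
  rw [triEntry, if_pos hj] at this
  simpa using this

theorem eq_zero_of_mem_triRow {ε : ℝ} {i j : Fin N} {y : Fin N → ℂ} (hy : y ∈ triRow ε i)
    (hj : i < j) : y j = 0 := by
  have := hy j
  rw [triEntry, if_neg hj.not_gt, if_neg hj.ne'] at this
  simpa using this

theorem exists_diag_of_mem_triRow {ε : ℝ} {i : Fin N} {y : Fin N → ℂ} (hy : y ∈ triRow ε i) :
    ∃ t ∈ Set.Icc 1 (1 + ε), ((t : ℝ) : ℂ) = y i := by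
  have := hy i
  rw [triEntry, if_neg (lt_irrefl _), if_pos rfl] at this
  exact this

theorem vecMul_eq_of_mem_triRow {ε : ℝ} {i : Fin N} {y : Fin N → ℂ} (hy : y ∈ triRow ε i)
    (A : Matrix (Fin N) (Fin N) ℂ) :
    y ᵥ* A = ∑ j ∈ Finset.Iio i, y j • A.row j + y i • A.row i := by
  have h1 : y ᵥ* A = ∑ j, y j • A.row j := by
    rw [Matrix.vecMul_eq_sum]; rfl
  rw [h1, ← Finset.sum_subset (Finset.subset_univ (Finset.Iic i)), ← Finset.Iio_insert,
    Finset.sum_insert (by simp), add_comm]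
  intro j _ hj
  rw [Finset.mem_Iic, not_le] at hj
  rw [eq_zero_of_mem_triRow hy hj, zero_smul]

/-- Uniqueness in Gram–Schmidt: the coefficients of `x` along the common earlier rows agree, so the
remaining parts `t • row i` and `s • row i` agree. The rows are unit vectors and `t, s ≥ 1`, which
forces `t = s`. -/
theorem row_eq_of_vecMul_star_mem_triRow {ε : ℝ} {U V : UGroup N} {i : Fin N} {x : Fin N → ℂ}
    (hU : x ᵥ* star U.1 ∈ triRow ε i) (hV : x ᵥ* star V.1 ∈ triRow ε i)
    (h : ∀ j < i, U.1.row j = V.1.row j) : U.1.row i = V.1.row i := by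
  have hy : ∀ j < i, (x ᵥ* star U.1) j = (x ᵥ* star V.1) j := fun j hj => by
    rw [vecMul_star_apply, vecMul_star_apply, h j hj]
  have h1 := vecMul_eq_of_mem_triRow hU U.1
  have h2 := vecMul_eq_of_mem_triRow hV V.1
  rw [vecMul_star_vecMul] at h1 h2
  have hs : ∑ j ∈ Finset.Iio i, (x ᵥ* star U.1) j • U.1.row j
      = ∑ j ∈ Finset.Iio i, (x ᵥ* star V.1) j • V.1.row j :=
    Finset.sum_congr rfl fun j hj => by
      rw [hy j (Finset.mem_Iio.1 hj), h j (Finset.mem_Iio.1 hj)]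
  have h3 : (x ᵥ* star U.1) i • U.1.row i = (x ᵥ* star V.1) i • V.1.row i := by
    rw [hs] at h1
    exact add_left_cancel (h1.symm.trans h2)
  obtain ⟨t, ht, hte⟩ := exists_diag_of_mem_triRow hU
  obtain ⟨s, hs, hse⟩ := exists_diag_of_mem_triRow hV
  rw [← hte, ← hse] at h3
  have h4 := congrArg (fun v : Fin N → ℂ => v ⬝ᵥ star v) h3
  simp only [star_smul, smul_dotProduct, dotProduct_smul, unitary_dotProduct_star, if_true,
    smul_eq_mul, mul_one, Complex.star_def, Complex.conj_ofReal] at h4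
  have h5 : t * t = s * s := by exact_mod_cast h4
  have h6 : t = s := by nlinarith [ht.1, hs.1]
  rw [h6] at h3
  have hs0 : (s : ℂ) ≠ 0 := by
    have : s ≠ 0 := by linarith [hs.1]
    exact_mod_cast this
  exact smul_right_injective _ hs0 h3

theorem row_eq_of_forall_mem_triRow {ε : ℝ} {k : ℕ} (hk : k ≤ N) {U V : UGroup N}
    {M : Fin k → Fin N → ℂ} (hU : ∀ i, M i ᵥ* star U.1 ∈ triRow ε (Fin.castLE hk i))
    (hV : ∀ i, M i ᵥ* star V.1 ∈ triRow ε (Fin.castLE hk i)) :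
    ∀ (n : ℕ) (h : n < k), U.1.row ⟨n, h.trans_le hk⟩ = V.1.row ⟨n, h.trans_le hk⟩ := by
  intro n
  induction n using Nat.strong_induction_on with
  | _ n ih =>
    intro h
    refine row_eq_of_vecMul_star_mem_triRow (hU ⟨n, h⟩) (hV ⟨n, h⟩) fun j hj => ?_
    exact ih j.1 hj (lt_trans hj h)

/-- The `k × N` matrices `T U` with `U` unitary and `T` lower triangular close to the identity. -/
def triFrames (N : ℕ) (ε : ℝ) (k : ℕ) (hk : k ≤ N) : Set (Fin k → Fin N → ℂ) :=
  {M | ∃ U : UGroup N, ∀ i, M i ᵥ* star U.1 ∈ triRow ε (Fin.castLE hk i)}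

/-- Since `U(N)` is compact, projecting a closed set along it gives a closed set. -/
theorem isClosed_triFrames (ε : ℝ) (k : ℕ) (hk : k ≤ N) : IsClosed (triFrames N ε k hk) := by
  have h : triFrames N ε k hk = Prod.fst '' (⋂ i, (fun p : (Fin k → Fin N → ℂ) × UGroup N =>
      p.1 i ᵥ* star p.2.1) ⁻¹' triRow ε (Fin.castLE hk i)) := by
    ext M
    simp [triFrames]
  rw [h]
  refine isClosedMap_fst_of_compactSpace _ (isClosed_iInter fun i =>
    (isClosed_triRow ε _).preimage ?_)
  exact ((continuous_apply i).comp continuous_fst).matrix_vecMul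
    (continuous_subtype_val.comp continuous_snd).star

/-- The possible `k`-th rows of `T U`, in coordinates with respect to the rows of `U`. -/
def sliceSet (N : ℕ) (ε : ℝ) (k : Fin N) : Set (Fin N → ℂ) :=
  {y | (∀ j < k, ‖y j‖ ≤ ε) ∧ (∑ j, ‖y j‖ ^ 2 - ∑ j ∈ Finset.Iio k, ‖y j‖ ^ 2) ∈
    Set.Icc 1 ((1 + ε) ^ 2)}

theorem sum_sub_sum_Iio {y : Fin N → ℝ} (k : Fin N) :
    ∑ j, y j - ∑ j ∈ Finset.Iio k, y j = ∑ j ∈ Finset.Ici k, y j := by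
  rw [sub_eq_iff_eq_add, add_comm, ← Finset.sum_union]
  · congr 1
    ext j
    simp [lt_or_ge]
  · rw [Finset.disjoint_left]
    intro j hj hj'
    exact absurd (Finset.mem_Ici.1 hj') (not_le.2 (Finset.mem_Iio.1 hj))

theorem triRow_subset_sliceSet {ε : ℝ} (k : Fin N) : triRow ε k ⊆ sliceSet N ε k := by
  intro y hy
  refine ⟨fun j hj => norm_le_of_mem_triRow hy hj, ?_⟩
  obtain ⟨t, ht, hte⟩ := exists_diag_of_mem_triRow hy
  rw [sum_sub_sum_Iio (y := fun j => ‖y j‖ ^ 2), Finset.sum_eq_single k, ← hte, Complex.norm_real,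
    Real.norm_eq_abs, sq_abs]
  · constructor <;> nlinarith [ht.1, ht.2]
  · intro j hj hjk
    rw [eq_zero_of_mem_triRow hy (lt_of_le_of_ne (Finset.mem_Ici.1 hj) hjk.symm)]
    simp
  · simp

/-- The slice condition involves only the coefficients along the first `k` rows and the total norm,
which every unitary change of basis preserves. -/
theorem vecMul_star_mem_sliceSet_congr {ε : ℝ} {k : Fin N} {U V : UGroup N}
    (h : ∀ j < k, U.1.row j = V.1.row j) {x : Fin N → ℂ}
    (hx : x ᵥ* star U.1 ∈ sliceSet N ε k) : x ᵥ* star V.1 ∈ sliceSet N ε k := by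
  have hy : ∀ j < k, (x ᵥ* star U.1) j = (x ᵥ* star V.1) j := fun j hj => by
    rw [vecMul_star_apply, vecMul_star_apply, h j hj]
  obtain ⟨h1, h2⟩ := hx
  refine ⟨fun j hj => hy j hj ▸ h1 j hj, ?_⟩
  rw [sum_normSq_vecMul_star] at h2 ⊢
  have hs : ∑ j ∈ Finset.Iio k, ‖(x ᵥ* star U.1) j‖ ^ 2 = ∑ j ∈ Finset.Iio k, ‖(x ᵥ* star V.1) j‖ ^ 2 :=
    Finset.sum_congr rfl fun j hj => by rw [hy j (Finset.mem_Iio.1 hj)]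
  rwa [← hs]

theorem exists_unitary_mem_triRow {ε : ℝ} (hε : 0 ≤ ε) {k : Fin N} {U : UGroup N} {x : Fin N → ℂ}
    (hx : x ᵥ* star U.1 ∈ sliceSet N ε k) :
    ∃ V : UGroup N, (∀ j < k, V.1.row j = U.1.row j) ∧ x ᵥ* star V.1 ∈ triRow ε k := by
  set y := x ᵥ* star U.1 with hy
  obtain ⟨h1, h2⟩ := hx
  rw [sum_sub_sum_Iio (y := fun j => ‖y j‖ ^ 2)] at h2
  set S := ∑ j ∈ Finset.Ici k, ‖y j‖ ^ 2 with hS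
  have hSpos : 0 < S := by linarith [h2.1]
  set t := Real.sqrt S with ht
  have ht2 : t * t = S := Real.mul_self_sqrt hSpos.le
  have ht0 : 0 < t := Real.sqrt_pos.2 hSpos
  have htc : (t : ℂ) ≠ 0 := by exact_mod_cast ht0.ne'
  -- In the basis of rows of `U`, this is the normalized component of `x` orthogonal to the rows
  -- before `k`, and `t` is the length of that component. It becomes the new row `k`.
  let z : Fin N → ℂ := fun j => if j < k then 0 else (t : ℂ)⁻¹ * y j
  have hzU : (z ᵥ* U.1) ᵥ* star U.1 = z := by
    rw [Matrix.vecMul_vecMul, unitary_mul_star, Matrix.vecMul_one]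
  have hzz : (z ᵥ* U.1) ⬝ᵥ star (z ᵥ* U.1) = 1 := by
    rw [← sum_normSq_eq_dotProduct, ← sum_normSq_vecMul_star _ U, hzU]
    have : ∑ j, ‖z j‖ ^ 2 = 1 := by
      rw [← Finset.sum_subset (Finset.subset_univ (Finset.Ici k))]
      · calc ∑ j ∈ Finset.Ici k, ‖z j‖ ^ 2 = ∑ j ∈ Finset.Ici k, (t * t)⁻¹ * ‖y j‖ ^ 2 := by
              refine Finset.sum_congr rfl fun j hj => ?_
              simp only [z, if_neg (not_lt.2 (Finset.mem_Ici.1 hj)), norm_mul, norm_inv,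
                Complex.norm_real, Real.norm_eq_abs, abs_of_pos ht0]
              rw [mul_pow, inv_pow, sq t]
          _ = 1 := by rw [← Finset.mul_sum, ht2, ← hS, inv_mul_cancel₀ hSpos.ne']
      · intro j _ hj
        rw [Finset.mem_Ici, not_le] at hj
        simp [z, hj]
    rw [this, Complex.ofReal_one]
  obtain ⟨V, hV, hVk⟩ := exists_unitary_extend U k hzz fun j hj => by
    rw [← vecMul_star_apply, hzU]
    simp [z, hj]
  refine ⟨V, hV, ?_⟩
  have hlt : ∀ j < k, (x ᵥ* star V.1) j = y j := fun j hj => by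
    rw [vecMul_star_apply, hV j hj, ← vecMul_star_apply]
  have hk : (x ᵥ* star V.1) k = t := by
    rw [vecMul_star_apply, hVk, ← vecMul_star_vecMul x U, ← hy, Matrix.star_vecMul,
      ← Matrix.dotProduct_mulVec, Matrix.mulVec_mulVec, ← Matrix.star_eq_conjTranspose,
      unitary_mul_star, Matrix.one_mulVec]
    have : ∀ j, y j * star (z j) = if k ≤ j then (((t⁻¹ * ‖y j‖ ^ 2 : ℝ)) : ℂ) else 0 := by
      intro j
      by_cases hj : j < k
      · simp [z, hj, not_le.2 hj]
      · simp only [z, if_neg hj, if_pos (not_lt.1 hj), Complex.star_def, map_mul, map_inv₀,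
          Complex.conj_ofReal]
        push_cast
        rw [← Complex.mul_conj']
        ring
    simp only [dotProduct, Pi.star_apply, this]
    rw [← Finset.sum_filter, ← Complex.ofReal_sum, ← Finset.mul_sum,
      show Finset.univ.filter (fun j => k ≤ j) = Finset.Ici k by ext; simp, ← hS, ← ht2]
    congr 1
    field_simp
  -- The total norm is preserved, the coefficients before `k` are unchanged, and the `k`-th one
  -- already carries `t² = S`; nothing is left for the later ones.
  have hsum : ∑ j ∈ Finset.Ioi k, ‖(x ᵥ* star V.1) j‖ ^ 2 = 0 := by
    have e1 : ∑ j, ‖(x ᵥ* star V.1) j‖ ^ 2 = ∑ j, ‖y j‖ ^ 2 := by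
      rw [hy, sum_normSq_vecMul_star, sum_normSq_vecMul_star]
    have e2 := sum_sub_sum_Iio (y := fun j => ‖(x ᵥ* star V.1) j‖ ^ 2) k
    have e3 := sum_sub_sum_Iio (y := fun j => ‖y j‖ ^ 2) k
    have e4 : ∑ j ∈ Finset.Iio k, ‖(x ᵥ* star V.1) j‖ ^ 2 = ∑ j ∈ Finset.Iio k, ‖y j‖ ^ 2 :=
      Finset.sum_congr rfl fun j hj => by rw [hlt j (Finset.mem_Iio.1 hj)]
    rw [← Finset.Ioi_insert, Finset.sum_insert (by simp), hk, Complex.norm_real, Real.norm_eq_abs,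
      sq_abs] at e2
    rw [← hS] at e3
    nlinarith
  have hgt : ∀ j, k < j → (x ᵥ* star V.1) j = 0 := fun j hj => by
    have := (Finset.sum_eq_zero_iff_of_nonneg fun _ _ => by positivity).1 hsum j
      (Finset.mem_Ioi.2 hj)
    simpa using this
  intro j
  rw [triEntry]
  split_ifs with hj hj'
  · rw [hlt j hj]
    simpa using h1 j hj
  · subst hj'
    refine ⟨t, ⟨?_, ?_⟩, hk.symm⟩
    · exact Real.one_le_sqrt.2 h2.1
    · exact (Real.sqrt_le_left (by linarith)).2 h2.2
  · exact hgt j (lt_of_le_of_ne (not_lt.1 hj) (Ne.symm hj'))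

end TriangularRows

/-! ### Volume of the triangular-times-unitary matrices, row by row. -/

section FrameVolume

open Matrix

variable {N : ℕ}

/-- The volume of the set of possible `k`-th rows. -/
def sliceVol (N : ℕ) (ε : ℝ) (k : ℕ) : ℝ≥0∞ :=
  volume (Metric.closedBall (0 : ℂ) ε) ^ k *
    ENNReal.ofReal (((1 + ε) ^ (2 * (N - k)) - 1) * (Real.pi ^ (N - k) / (N - k).factorial))

theorem measurableSet_sliceSet (ε : ℝ) (k : Fin N) : MeasurableSet (sliceSet N ε k) := by
  have h : sliceSet N ε k = (⋂ j ∈ Set.Iio k, {y : Fin N → ℂ | ‖y j‖ ≤ ε}) ∩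
      (fun y : Fin N → ℂ => ∑ j, ‖y j‖ ^ 2 - ∑ j ∈ Finset.Iio k, ‖y j‖ ^ 2) ⁻¹'
        Set.Icc 1 ((1 + ε) ^ 2) := by
    ext y; simp [sliceSet]
  rw [h]
  refine MeasurableSet.inter (MeasurableSet.biInter (Set.to_countable _) fun j _ => ?_)
    (measurableSet_Icc.preimage (by fun_prop))
  exact measurableSet_le (by fun_prop) measurable_const

theorem volume_sliceSet {ε : ℝ} (hε : 0 ≤ ε) (k : Fin N) :
    volume (sliceSet N ε k) = sliceVol N ε k := by
  have hmp := volume_preserving_piEquivPiSubtypeProd (fun _ : Fin N => ℂ) (fun j => j < k)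
  have hset : sliceSet N ε k = MeasurableEquiv.piEquivPiSubtypeProd (fun _ : Fin N => ℂ)
      (fun j => j < k) ⁻¹' ((Set.univ.pi fun _ : {j // j < k} => Metric.closedBall (0 : ℂ) ε) ×ˢ
        {x : {j // ¬ j < k} → ℂ | ∑ i, ‖x i‖ ^ 2 ∈ Set.Icc 1 ((1 + ε) ^ 2)}) := by
    ext y
    have hs : ∑ i : {j // ¬ j < k}, ‖y i‖ ^ 2 = ∑ j ∈ Finset.Ici k, ‖y j‖ ^ 2 :=
      (Finset.sum_subtype (Finset.Ici k) (by simp) fun j => ‖y j‖ ^ 2).symm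
    have hI := sum_sub_sum_Iio (y := fun j => ‖y j‖ ^ 2) k
    change _ ↔ (∀ i : {j // j < k}, i ∈ Set.univ → y i ∈ Metric.closedBall (0 : ℂ) ε) ∧
      ∑ i : {j // ¬ j < k}, ‖y i‖ ^ 2 ∈ Set.Icc 1 ((1 + ε) ^ 2)
    rw [hs, ← hI]
    simp [sliceSet]
  have hne : Nonempty {j // ¬ j < k} := ⟨⟨k, lt_irrefl _⟩⟩
  have hc1 : Fintype.card {j // j < k} = k := by
    rw [Fintype.card_subtype, show Finset.univ.filter (fun j => j < k) = Finset.Iio k by ext; simp,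
      Fin.card_Iio]
  have hc2 : Fintype.card {j // ¬ j < k} = N - k := by
    rw [Fintype.card_subtype_compl, hc1, Fintype.card_fin]
  rw [hset, hmp.measure_preimage_equiv, Measure.volume_eq_prod, Measure.prod_prod, volume_shell _ hε,
    volume_pi_pi, Finset.prod_const, Finset.card_univ, hc1, hc2, sliceVol]

/-- By uniqueness, every factorization of `M` uses the same first `k` rows as `U`, so the condition
on the new row can be tested with `U`. Conversely, `U` is changed from row `k` on to accommodate the
new row. -/
theorem mem_triFrames_succ_iff {ε : ℝ} (hε : 0 ≤ ε) {k : ℕ} (hk : k + 1 ≤ N)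
    {M : Fin (k + 1) → Fin N → ℂ} {U : UGroup N}
    (hU : ∀ i : Fin k, M i.castSucc ᵥ* star U.1 ∈ triRow ε (Fin.castLE (Nat.le_of_succ_le hk) i)) :
    M ∈ triFrames N ε (k + 1) hk ↔ M (Fin.last k) ᵥ* star U.1 ∈ sliceSet N ε ⟨k, hk⟩ := by
  constructor
  · rintro ⟨V, hV⟩
    have hrow := row_eq_of_forall_mem_triRow (Nat.le_of_succ_le hk) (M := fun i => M i.castSucc)
      (U := V) (V := U) (fun i => hV i.castSucc) hU
    exact vecMul_star_mem_sliceSet_congr (fun j hj => hrow j.1 hj)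
      (triRow_subset_sliceSet _ (hV (Fin.last k)))
  · intro h
    obtain ⟨V, hV, hx⟩ := exists_unitary_mem_triRow hε h
    refine ⟨V, fun i => ?_⟩
    induction i using Fin.lastCases with
    | last => exact hx
    | cast i =>
      have hi := hU i
      intro j
      by_cases hji : j ≤ Fin.castLE (Nat.le_of_succ_le hk) i
      · rw [vecMul_star_apply, hV j (lt_of_le_of_lt hji (Fin.mk_lt_mk.2 i.2)), ← vecMul_star_apply]
        exact hi j
      -- Row `i` of `M` lies in the span of the rows of `U` up to `i`. These are also rows of `V`,
      -- hence orthogonal to its row `j > i`.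
      · rw [not_le] at hji
        have hrow := vecMul_eq_of_mem_triRow hi U.1
        rw [vecMul_star_vecMul] at hrow
        have : (M i.castSucc ᵥ* star V.1) j = 0 := by
          have hlt : ∀ l ≤ Fin.castLE (Nat.le_of_succ_le hk) i, U.1.row l ⬝ᵥ star (V.1.row j) = 0 := by
            intro l hl
            rw [← hV l (lt_of_le_of_lt hl (Fin.mk_lt_mk.2 i.2)), unitary_dotProduct_star,
              if_neg (lt_of_le_of_lt hl hji).ne]
          rw [vecMul_star_apply, hrow, add_dotProduct, sum_dotProduct, smul_dotProduct,
            hlt _ le_rfl, Finset.sum_eq_zero, smul_zero, add_zero]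
          intro l hl
          rw [smul_dotProduct, hlt l (Finset.mem_Iio.1 hl).le, smul_zero]
        rw [this, triEntry]
        have hcast : Fin.castLE hk i.castSucc = Fin.castLE (Nat.le_of_succ_le hk) i := rfl
        rw [hcast, if_neg hji.not_gt, if_neg hji.ne']
        rfl

/-- Fubini in the last row: over each admissible choice of the earlier rows, the slice is a unitary
image of `sliceSet`, so its volume does not depend on that choice. -/
theorem volume_triFrames {ε : ℝ} (hε : 0 ≤ ε) : ∀ (k : ℕ) (hk : k ≤ N),
    volume (triFrames N ε k hk) = ∏ i ∈ Finset.range k, sliceVol N ε i := by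
  intro k
  induction k with
  | zero =>
    intro hk
    have : triFrames N ε 0 hk = Set.univ := by
      ext M
      simp only [Set.mem_univ, iff_true]
      exact ⟨1, fun i => i.elim0⟩
    rw [this, Finset.prod_range_zero, volume_pi, Measure.pi_univ]
    simp
  | succ k ih =>
    intro hk
    have hk' : k ≤ N := Nat.le_of_succ_le hk
    have hmp := (volume_preserving_piFinSuccAbove (fun _ : Fin (k + 1) => Fin N → ℂ)
      (Fin.last k)).symm
    rw [Finset.prod_range_succ, ← ih hk', ← hmp.measure_preimage_equiv, Measure.volume_eq_prod,
      Measure.prod_apply_symm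
        ((MeasurableEquiv.measurable _) (isClosed_triFrames ε (k + 1) hk).measurableSet)]
    have hslice : ∀ M : Fin k → Fin N → ℂ,
        volume ((fun x => (x, M)) ⁻¹' ((MeasurableEquiv.piFinSuccAbove
          (fun _ : Fin (k + 1) => Fin N → ℂ) (Fin.last k)).symm ⁻¹' triFrames N ε (k + 1) hk))
        = (triFrames N ε k hk').indicator (fun _ => sliceVol N ε k) M := by
      intro M
      have hset : ((fun x => (x, M)) ⁻¹' ((MeasurableEquiv.piFinSuccAbove
          (fun _ : Fin (k + 1) => Fin N → ℂ) (Fin.last k)).symm ⁻¹' triFrames N ε (k + 1) hk))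
          = {x | (Fin.snoc M x : Fin (k + 1) → Fin N → ℂ) ∈ triFrames N ε (k + 1) hk} := by
        ext x
        have : (MeasurableEquiv.piFinSuccAbove
          (fun _ : Fin (k + 1) => Fin N → ℂ) (Fin.last k)).symm (x, M) = Fin.snoc M x :=
          Fin.insertNth_last' x M
        simp only [Set.mem_preimage, this, Set.mem_ofPred_eq]
      rw [hset]
      by_cases hM : M ∈ triFrames N ε k hk'
      · rw [Set.indicator_of_mem hM]
        obtain ⟨U, hU⟩ := hM
        have : {x | (Fin.snoc M x : Fin (k + 1) → Fin N → ℂ) ∈ triFrames N ε (k + 1) hk}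
            = (fun x => x ᵥ* star U.1) ⁻¹' sliceSet N ε ⟨k, hk⟩ := by
          ext x
          rw [Set.mem_ofPred_eq, mem_triFrames_succ_iff hε hk (U := U)
            (fun i => by rw [Fin.snoc_castSucc]; exact hU i), Fin.snoc_last]
          rfl
        rw [this]
        have h := (measurePreserving_vecMul U⁻¹).measure_preimage
          (measurableSet_sliceSet ε (⟨k, hk⟩ : Fin N)).nullMeasurableSet
        rw [volume_sliceSet hε] at h
        exact h
      · rw [Set.indicator_of_notMem hM]
        convert measure_empty (μ := (volume : Measure (Fin N → ℂ)))
        ext x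
        simp only [Set.mem_ofPred_eq, Set.mem_empty_iff_false, iff_false]
        rintro ⟨U, hU⟩
        refine hM ⟨U, fun i => ?_⟩
        have := hU i.castSucc
        rwa [Fin.snoc_castSucc] at this
    simp_rw [hslice]
    rw [lintegral_indicator (isClosed_triFrames ε k hk').measurableSet, setLIntegral_const, mul_comm]

end FrameVolume

/-! ### Separating the Haar measure of the unitary factor. -/

section TriangularSets

open Matrix

variable {N : ℕ}

instance : IsProbabilityMeasure (haarU N) := ⟨Measure.haarMeasure_self⟩

instance : (haarU N).IsMulLeftInvariant :=
  inferInstanceAs (Measure.haarMeasure (⊤ : TopologicalSpace.PositiveCompacts (UGroup N))).IsMulLeftInvariant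

/-- The products `T U` with `U ∈ C` and `T` lower triangular close to the identity. -/
def triSet (ε : ℝ) (C : Set (UGroup N)) : Set (Fin N → Fin N → ℂ) :=
  {M | ∃ U ∈ C, ∀ i, M i ᵥ* star U.1 ∈ triRow ε i}

theorem triSet_univ (ε : ℝ) : triSet ε (Set.univ : Set (UGroup N)) = triFrames N ε N le_rfl := by
  ext M
  simp [triSet, triFrames]

theorem isClosed_triSet (ε : ℝ) {C : Set (UGroup N)} (hC : IsClosed C) : IsClosed (triSet ε C) := by
  have h : triSet ε C = Prod.fst '' ((Prod.snd ⁻¹' C) ∩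
      ⋂ i, (fun p : (Fin N → Fin N → ℂ) × UGroup N => p.1 i ᵥ* star p.2.1) ⁻¹' triRow ε i) := by
    ext M
    simp [triSet]
  rw [h]
  refine isClosedMap_fst_of_compactSpace _ ((hC.preimage continuous_snd).inter
    (isClosed_iInter fun i => (isClosed_triRow ε _).preimage ?_))
  exact ((continuous_apply i).comp continuous_fst).matrix_vecMul
    (continuous_subtype_val.comp continuous_snd).star

/-- If `M = T V`, then `M U = T (V U)`, and uniqueness of the factorization makes `V U` the only
possible unitary factor. -/
theorem vecMul_mem_triSet_iff {ε : ℝ} {C : Set (UGroup N)} {M : Fin N → Fin N → ℂ} {V : UGroup N}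
    (hV : ∀ i, M i ᵥ* star V.1 ∈ triRow ε i) (U : UGroup N) :
    (fun i => M i ᵥ* U.1) ∈ triSet ε C ↔ V * U ∈ C := by
  have hmul : ∀ W : UGroup N, ∀ i, (M i ᵥ* U.1) ᵥ* star W.1 = M i ᵥ* star (W * U⁻¹).1 := by
    intro W i
    have : (W * U⁻¹).1 = W.1 * star U.1 := rfl
    rw [Matrix.vecMul_vecMul, this, star_mul, star_star]
  constructor
  · rintro ⟨W, hW, h⟩
    simp only [hmul] at h
    have hrow := row_eq_of_forall_mem_triRow le_rfl (M := M) (U := W * U⁻¹) (V := V) h hV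
    have : W * U⁻¹ = V := Subtype.ext (funext fun i => hrow i.1 i.2)
    rwa [← this, inv_mul_cancel_right]
  · intro h
    refine ⟨V * U, h, fun i => ?_⟩
    simp only [hmul, mul_inv_cancel_right]
    exact hV i

/-- Measure the pairs `(M, U)` with `M U ∈ triSet ε C` in two ways. For fixed `U`, unitary
invariance gives the volume of `triSet ε C`. For fixed `M = T V`, the condition is `V U ∈ C`, of
Haar measure `σ(C)` by left invariance. -/
theorem volume_triSet (ε : ℝ) {C : Set (UGroup N)} (hC : IsClosed C) :
    volume (triSet ε C) = haarU N C * volume (triSet ε (Set.univ : Set (UGroup N))) := by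
  let S : Set ((Fin N → Fin N → ℂ) × UGroup N) := {p | (fun i => p.1 i ᵥ* p.2.1) ∈ triSet ε C}
  have hS : MeasurableSet S := by
    refine ((isClosed_triSet ε hC).preimage (continuous_pi fun i => ?_)).measurableSet
    exact ((continuous_apply i).comp continuous_fst).matrix_vecMul
      (continuous_subtype_val.comp continuous_snd)
  have h1 : ((volume : Measure (Fin N → Fin N → ℂ)).prod (haarU N)) S = volume (triSet ε C) := by
    rw [Measure.prod_apply_symm hS]
    have : ∀ U : UGroup N, volume ((fun M => (M, U)) ⁻¹' S) = volume (triSet ε C) := fun U =>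
      (volume_preserving_pi fun _ : Fin N => measurePreserving_vecMul U).measure_preimage
        (isClosed_triSet ε hC).measurableSet.nullMeasurableSet
    simp_rw [this]
    rw [lintegral_const, measure_univ, mul_one]
  rw [← h1, Measure.prod_apply hS]
  have h2 : ∀ M : Fin N → Fin N → ℂ, haarU N (Prod.mk M ⁻¹' S)
      = (triSet ε (Set.univ : Set (UGroup N))).indicator (fun _ => haarU N C) M := by
    intro M
    by_cases hM : M ∈ triSet ε (Set.univ : Set (UGroup N))
    · rw [Set.indicator_of_mem hM]
      obtain ⟨V, -, hV⟩ := hM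
      rw [← measure_preimage_mul (haarU N) V C]
      congr 1
      ext U
      exact vecMul_mem_triSet_iff hV U
    · rw [Set.indicator_of_notMem hM]
      convert measure_empty (μ := haarU N)
      ext U
      simp only [Set.mem_empty_iff_false, iff_false]
      rintro ⟨W, -, h⟩
      refine hM ⟨W * U⁻¹, Set.mem_univ _, fun i => ?_⟩
      have : (W * U⁻¹).1 = W.1 * star U.1 := rfl
      rw [this, star_mul, star_star, ← Matrix.vecMul_vecMul]
      exact h i
  simp_rw [h2]
  rw [lintegral_indicator (isClosed_triSet ε isClosed_univ).measurableSet, setLIntegral_const]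

end TriangularSets

/-! ### The map `X + iH ↦ (1 + X)e^{iH}` near the origin. -/

section LocalChart

open Matrix

variable {N : ℕ}

/-- The lower triangular part `X` in the decomposition `M = X + iH` with `H` Hermitian and `X`
lower triangular with real diagonal. -/
def triPart : Matrix (Fin N) (Fin N) ℂ →ₗ[ℝ] Matrix (Fin N) (Fin N) ℂ where
  toFun M := Matrix.of fun j k => if k < j then M j k + star (M k j) else
    if k = j then ((M j j).re : ℂ) else 0
  map_add' M M' := by
    ext j k
    simp only [Matrix.of_apply, Matrix.add_apply]
    split_ifs
    · rw [star_add]; ring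
    · simp
    · simp
  map_smul' c M := by
    ext j k
    simp only [Matrix.of_apply, Matrix.smul_apply, RingHom.id_apply]
    split_ifs
    · rw [star_smul, smul_add]; simp
    · simp
    · simp

/-- The coordinates of `H` in the decomposition `M = X + iH` with `H` Hermitian and `X`
lower triangular with real diagonal. -/
def skewCoords (M : Matrix (Fin N) (Fin N) ℂ) (p : Fin N × Fin N) : ℝ :=
  if p.1 = p.2 then (M p.1 p.1).im
  else if p.1 < p.2 then Real.sqrt 2 * (M p.1 p.2).im
  else -(Real.sqrt 2 * (M p.2 p.1).re)

theorem I_smul_hermOfCoords_skewCoords (M : Matrix (Fin N) (Fin N) ℂ) :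
    Complex.I • (hermOfCoords (skewCoords M)).1 = M - triPart M := by
  have h2 : ((Real.sqrt 2 : ℝ) : ℂ) ≠ 0 := by
    exact_mod_cast (Real.sqrt_pos.2 two_pos).ne'
  ext j k
  simp only [triPart, hermOfCoords, skewCoords, Matrix.smul_apply, Matrix.sub_apply,
    LinearMap.coe_mk, AddHom.coe_mk, Matrix.of_apply, smul_eq_mul]
  rcases lt_trichotomy j k with h | h | h
  · simp only [h.ne, h.ne', h, h.not_gt, if_false, if_true]
    apply Complex.ext <;> simp [field]
  · subst h
    apply Complex.ext <;> simp
  · simp only [h.ne, h.ne', h, h.not_gt, if_false, if_true]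
    apply Complex.ext <;> simp [field]

theorem skewCoords_add_I_smul {X : Matrix (Fin N) (Fin N) ℂ} (x : Fin N × Fin N → ℝ)
    (hd : ∀ j, (X j j).im = 0) (hu : ∀ j k, j < k → X j k = 0) :
    skewCoords (X + Complex.I • (hermOfCoords x).1) = x := by
  have h2 : Real.sqrt 2 ≠ 0 := (Real.sqrt_pos.2 two_pos).ne'
  funext p
  obtain ⟨j, k⟩ := p
  simp only [skewCoords, hermOfCoords, Matrix.add_apply, Matrix.smul_apply, Matrix.of_apply]
  rcases lt_trichotomy j k with h | h | h
  · simp only [h.ne, h.ne', h, h.not_gt, if_false, if_true, hu j k h]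
    simp [field]
  · subst h
    simp [hd]
  · simp only [h.ne, h.ne', h, h.not_gt, if_false, if_true, hu k j h]
    simp [field]

/-- The map `X + iH ↦ (1 + X) e^{iH}`. -/
def triExp (M : Matrix (Fin N) (Fin N) ℂ) : Matrix (Fin N) (Fin N) ℂ :=
  (1 + triPart M) * NormedSpace.exp (M - triPart M)

theorem triExp_eq (M : Matrix (Fin N) (Fin N) ℂ) :
    triExp M = (1 + triPart M) * (expChart (skewCoords M)).1 := by
  rw [triExp, ← I_smul_hermOfCoords_skewCoords]
  rfl

open scoped Matrix.Norms.Frobenius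

/-- By the product rule the two factors contribute the triangular part `X` and the skew part `iH`,
whose sum is `M`. -/
theorem hasStrictFDerivAt_triExp : HasStrictFDerivAt (𝕜 := ℝ) (triExp (N := N))
    (ContinuousLinearMap.id ℝ (Matrix (Fin N) (Fin N) ℂ)) 0 := by
  have hT : HasStrictFDerivAt (𝕜 := ℝ) (fun M : Matrix (Fin N) (Fin N) ℂ => 1 + triPart M)
      (LinearMap.toContinuousLinearMap (triPart (N := N))) 0 :=
    (LinearMap.toContinuousLinearMap (triPart (N := N))).hasStrictFDerivAt.const_add 1
  have hS : HasStrictFDerivAt (𝕜 := ℝ) (fun M : Matrix (Fin N) (Fin N) ℂ => M - triPart M)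
      (ContinuousLinearMap.id ℝ _ - LinearMap.toContinuousLinearMap (triPart (N := N))) 0 :=
    (hasStrictFDerivAt_id 0).sub (LinearMap.toContinuousLinearMap (triPart (N := N))).hasStrictFDerivAt
  have hE : HasStrictFDerivAt (𝕜 := ℝ) (NormedSpace.exp : Matrix (Fin N) (Fin N) ℂ → _)
      (1 : Matrix (Fin N) (Fin N) ℂ →L[ℝ] Matrix (Fin N) (Fin N) ℂ)
      ((0 : Matrix (Fin N) (Fin N) ℂ) - triPart 0) := by
    rw [map_zero, sub_zero]
    exact hasStrictFDerivAt_exp_zero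
  have h := hT.mul' (hE.comp 0 hS)
  refine h.congr_fderiv ?_
  ext1 M
  simp only [map_zero, add_zero, sub_zero, NormedSpace.exp_zero, one_smul]
  change M - triPart M + triPart M * 1 = M
  rw [mul_one, sub_add_cancel]

/-- Strict differentiability makes `f` uniformly close to the identity on a neighbourhood, and a map
close enough to a linear one distorts the measure of every subset by nearly the determinant. -/
theorem exists_nhds_addHaar_image {E : Type*} [NormedAddCommGroup E] [NormedSpace ℝ E]
    [FiniteDimensional ℝ E] [MeasurableSpace E] [BorelSpace E] (μ : Measure E) [μ.IsAddHaarMeasure]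
    {f : E → E} {x : E} (hf : HasStrictFDerivAt f (ContinuousLinearMap.id ℝ E) x) {m m' : ℝ≥0}
    (hm : m < 1) (hm' : 1 < m') :
    ∃ s₀ ∈ nhds x, ∀ s ⊆ s₀, m * μ s ≤ μ (f '' s) ∧ μ (f '' s) ≤ m' * μ s := by
  have hdet : ENNReal.ofReal |(ContinuousLinearMap.id ℝ E).det| = 1 := by
    have : (ContinuousLinearMap.id ℝ E).det = 1 := LinearMap.det_id
    rw [this, abs_one, ENNReal.ofReal_one]
  have h1 := addHaar_image_le_mul_of_det_lt μ (ContinuousLinearMap.id ℝ E)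
    (m := m') (by rw [hdet]; exact_mod_cast hm')
  have h2 := mul_le_addHaar_image_of_lt_det μ (ContinuousLinearMap.id ℝ E)
    (m := m) (by rw [hdet]; exact_mod_cast hm)
  obtain ⟨δ, ⟨hδ1, hδ2⟩, hδ⟩ := ((h1.and h2).and self_mem_nhdsWithin).exists
  obtain ⟨s₀, hs₀, happ⟩ := hf.approximates_deriv_on_nhds (Or.inr hδ)
  exact ⟨s₀, hs₀, fun s hs => ⟨hδ2 s _ (happ.mono_set hs), hδ1 s _ (happ.mono_set hs)⟩⟩

theorem exists_nhds_volume_image_triExp {m m' : ℝ≥0} (hm : m < 1) (hm' : 1 < m') :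
    ∃ s₀ ∈ nhds (0 : Fin N → Fin N → ℂ), ∀ s ⊆ s₀,
      m * volume s ≤ volume (triExp '' s : Set (Fin N → Fin N → ℂ)) ∧
      volume (triExp '' s : Set (Fin N → Fin N → ℂ)) ≤ m' * volume s := by
  have hB : BorelSpace (Fin N → Fin N → ℂ) := inferInstance
  have hμ : (volume : Measure (Fin N → Fin N → ℂ)).IsAddHaarMeasure :=
    Measure.pi.isAddHaarMeasure fun _ => (volume : Measure (Fin N → ℂ))
  -- The derivative is taken in the Frobenius norm on `Matrix`, whereas `volume` lives on the
  -- function type; the explicit arguments carry the product measurable structure across.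
  exact @exists_nhds_addHaar_image (Matrix (Fin N) (Fin N) ℂ) _ _ _ MeasurableSpace.pi hB
    (volume : Measure (Fin N → Fin N → ℂ)) hμ _ _ hasStrictFDerivAt_triExp _ _ hm hm'

end LocalChart

/-! ### An explicit set of matrices and its volume. -/

section TestBox

open Matrix

variable {N : ℕ}

/-- A box of coordinates of Hermitian matrices. -/
def coordBox (N : ℕ) (t : ℝ) : Set (Fin N × Fin N → ℝ) :=
  Set.univ.pi fun p => Set.Icc (-(if p.1 = p.2 then t else Real.sqrt 2 * t))
    (if p.1 = p.2 then t else Real.sqrt 2 * t)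

/-- The matrices `X + iH` with the coordinates of `H` in `coordBox` and `1 + X` lower triangular
close to the identity. -/
def testBox (N : ℕ) (t : ℝ) : Set (Fin N → Fin N → ℂ) :=
  {M | ∀ j k, (j = k → (M j k).re ∈ Set.Icc 0 t ∧ (M j k).im ∈ Set.Icc (-t) t) ∧
    (j < k → (M j k).re ∈ Set.Icc (-t) t ∧ (M j k).im ∈ Set.Icc (-t) t) ∧
    (k < j → ‖M j k + star (M k j)‖ ≤ t)}

/-- The upper entries of `M = X + iH` are those of `iH`; below the diagonal `iH` has entry `-star (M
k j)`, so that `M j k + star (M k j)` is the entry of `X`. The `√2` in `coordBox` cancels the `1/√2`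
of `hermOfCoords`. -/
theorem mem_testBox_iff {t : ℝ} {M : Matrix (Fin N) (Fin N) ℂ} :
    M ∈ testBox N t ↔ skewCoords M ∈ coordBox N t ∧ ∀ i, (1 + triPart M).row i ∈ triRow t i := by
  have h2 : 0 < Real.sqrt 2 := Real.sqrt_pos.2 two_pos
  have hrow : ∀ j k, (1 + triPart M).row j k = (if j = k then 1 else 0) +
      (if k < j then M j k + star (M k j) else if k = j then ((M j j).re : ℂ) else 0) :=
    fun j k => by
      change (1 : Matrix (Fin N) (Fin N) ℂ) j k + _ = _
      rw [Matrix.one_apply]; rfl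
  have hscale : ∀ a : ℝ, Real.sqrt 2 * a ∈ Set.Icc (-(Real.sqrt 2 * t)) (Real.sqrt 2 * t) ↔
      a ∈ Set.Icc (-t) t := by
    intro a
    rw [Set.mem_Icc, Set.mem_Icc, ← mul_neg, mul_le_mul_iff_right₀ h2, mul_le_mul_iff_right₀ h2]
  have hneg : ∀ a b : ℝ, -a ∈ Set.Icc (-b) b ↔ a ∈ Set.Icc (-b) b := by
    intro a b
    simp only [Set.mem_Icc]
    constructor <;> rintro ⟨h1, h2⟩ <;> constructor <;> linarith
  constructor
  · intro hM
    refine ⟨?_, fun i j => ?_⟩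
    · rintro ⟨j, k⟩ -
      simp only [skewCoords]
      rcases lt_trichotomy j k with h | h | h
      · simp only [h.ne, h, if_false, if_true]
        exact (hscale _).2 ((hM j k).2.1 h).2
      · subst h
        simp only [if_true]
        exact ((hM j j).1 rfl).2
      · simp only [h.ne', h.not_gt, if_false]
        exact (hneg _ _).2 ((hscale _).2 ((hM k j).2.1 h).1)
    · rw [hrow, triEntry]
      rcases lt_trichotomy j i with h | h | h
      · simp only [h, h.ne', if_true, if_false, zero_add]
        simpa using (hM i j).2.2 h
      · subst h
        simp only [lt_irrefl, if_true, if_false]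
        obtain ⟨h1, h2⟩ := ((hM j j).1 rfl).1
        exact ⟨1 + (M j j).re, ⟨by linarith, by linarith⟩, by push_cast; rfl⟩
      · simp [h.not_gt, h.ne, h.ne']
  · rintro ⟨hx, hT⟩ j k
    refine ⟨?_, ?_, ?_⟩
    · rintro rfl
      have h1 := hx (j, j) trivial
      simp only [skewCoords, if_true] at h1
      refine ⟨?_, h1⟩
      have h2 := hT j j
      rw [hrow, triEntry] at h2
      simp only [lt_irrefl, if_true, if_false] at h2
      obtain ⟨s, hs, hse⟩ := h2
      have : s = 1 + (M j j).re := by exact_mod_cast hse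
      constructor <;> linarith [hs.1, hs.2]
    · intro h
      have h1 := hx (j, k) trivial
      have h2 := hx (k, j) trivial
      simp only [skewCoords, h.ne, h.ne', h, h.not_gt, if_false, if_true] at h1 h2
      exact ⟨(hscale _).1 ((hneg _ _).1 h2), (hscale _).1 h1⟩
    · intro h
      have h2 := hT j k
      rw [hrow, triEntry] at h2
      simp only [h, h.ne', if_true, if_false, zero_add] at h2
      simpa using h2

theorem image_triExp_testBox (t : ℝ) :
    (triExp '' testBox N t : Set (Fin N → Fin N → ℂ)) = triSet t (expChart '' coordBox N t) := by
  ext M'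
  constructor
  · rintro ⟨M, hM, rfl⟩
    obtain ⟨hx, hT⟩ := mem_testBox_iff.1 hM
    refine ⟨_, ⟨_, hx, rfl⟩, fun i => ?_⟩
    have : triExp M i = (1 + triPart M).row i ᵥ* (expChart (skewCoords M)).1 := by
      rw [triExp_eq, Matrix.mul_apply_eq_vecMul]; rfl
    rw [this, Matrix.vecMul_vecMul, unitary_mul_star, Matrix.vecMul_one]
    exact hT i
  · rintro ⟨_, ⟨x, hx, rfl⟩, hT⟩
    let T : Matrix (Fin N) (Fin N) ℂ := Matrix.of fun i => M' i ᵥ* star (expChart x).1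
    have hTrow : ∀ i, T i ∈ triRow t i := hT
    have hd : ∀ j, ((T - 1) j j).im = 0 := fun j => by
      obtain ⟨s, -, hs⟩ := exists_diag_of_mem_triRow (hTrow j)
      rw [Matrix.sub_apply, Matrix.one_apply_eq, ← hs]
      simp
    have hu : ∀ j k, j < k → (T - 1) j k = 0 := fun j k h => by
      rw [Matrix.sub_apply, Matrix.one_apply_ne h.ne, eq_zero_of_mem_triRow (hTrow j) h, sub_zero]
    set M : Matrix (Fin N) (Fin N) ℂ := (T - 1) + Complex.I • (hermOfCoords x).1 with hMdef
    have hskew : skewCoords M = x := skewCoords_add_I_smul x hd hu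
    have htri : 1 + triPart M = T := by
      have := I_smul_hermOfCoords_skewCoords M
      rw [hskew] at this
      have h' : triPart M = M - Complex.I • (hermOfCoords x).1 := by rw [this]; abel
      rw [h', hMdef]; abel
    refine ⟨M, mem_testBox_iff.2 ⟨hskew.symm ▸ hx, fun i => ?_⟩, ?_⟩
    · rw [htri]; exact hTrow i
    · rw [triExp_eq, htri, hskew]
      funext i
      rw [Matrix.mul_apply_eq_vecMul]
      exact vecMul_star_vecMul (M' i) (expChart x)

theorem norm_le_of_mem_testBox {t : ℝ} {M : Fin N → Fin N → ℂ} (hM : M ∈ testBox N t)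
    (j k : Fin N) : ‖M j k‖ ≤ 3 * t := by
  have hup : ∀ j k, j ≤ k → ‖M j k‖ ≤ 2 * t := fun j k h => by
    have h1 : |(M j k).re| ≤ t ∧ |(M j k).im| ≤ t := by
      rcases h.lt_or_eq with h | h
      · obtain ⟨h1, h2⟩ := (hM j k).2.1 h
        exact ⟨abs_le.2 h1, abs_le.2 h2⟩
      · obtain ⟨h1, h2⟩ := (hM j k).1 h
        exact ⟨abs_le.2 ⟨by linarith [h1.1, h1.2], h1.2⟩, abs_le.2 h2⟩
    linarith [Complex.norm_le_abs_re_add_abs_im (M j k), h1.1, h1.2]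
  rcases le_or_gt j k with h | h
  · have := hup j k h
    linarith [norm_nonneg (M j k)]
  · have h1 := (hM j k).2.2 h
    have h2 := hup k j h.le
    have h3 := norm_sub_le (M j k + star (M k j)) (star (M k j))
    rw [add_sub_cancel_right, norm_star] at h3
    linarith

theorem measurePreserving_uncurry :
    MeasurePreserving (MeasurableEquiv.curry (Fin N) (Fin N) ℂ).symm volume volume := by
  refine ⟨MeasurableEquiv.measurable _, ?_⟩
  rw [volume_pi (ι := Fin N × Fin N)]
  refine (Measure.pi_eq fun s hs => ?_).symm
  rw [MeasurableEquiv.map_apply]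
  have : (MeasurableEquiv.curry (Fin N) (Fin N) ℂ).symm ⁻¹' (Set.univ.pi s)
      = Set.univ.pi fun i => Set.univ.pi fun j => s (i, j) := by
    ext M
    simp only [Set.mem_preimage, Set.mem_pi, Set.mem_univ, true_implies, Prod.forall]
    rfl
  rw [this, volume_pi_pi, Fintype.prod_prod_type]
  exact Finset.prod_congr rfl fun i _ => volume_pi_pi _

theorem volume_reIm_rect (a b c d : ℝ) :
    volume {z : ℂ | z.re ∈ Set.Icc a b ∧ z.im ∈ Set.Icc c d}
      = ENNReal.ofReal (b - a) * ENNReal.ofReal (d - c) := by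
  have : {z : ℂ | z.re ∈ Set.Icc a b ∧ z.im ∈ Set.Icc c d}
      = Complex.measurableEquivRealProd ⁻¹' (Set.Icc a b ×ˢ Set.Icc c d) := by
    ext z; rfl
  rw [this, Complex.volume_preserving_equiv_real_prod.measure_preimage_equiv,
    Measure.volume_eq_prod, Measure.prod_prod, Real.volume_Icc, Real.volume_Icc]

/-- The upper triangular entries of the elements of `testBox`. -/
def upperEntry (N : ℕ) (t : ℝ) (p : Fin N × Fin N) : Set ℂ :=
  {z : ℂ | z.re ∈ Set.Icc (if p.1 = p.2 then 0 else -t) t ∧ z.im ∈ Set.Icc (-t) t}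

theorem measurableSet_testBox (t : ℝ) : MeasurableSet (testBox N t) := by
  have h : testBox N t = ⋂ j, ⋂ k, {M | (j = k → (M j k).re ∈ Set.Icc 0 t ∧ (M j k).im ∈ Set.Icc (-t) t) ∧
    (j < k → (M j k).re ∈ Set.Icc (-t) t ∧ (M j k).im ∈ Set.Icc (-t) t) ∧
    (k < j → ‖M j k + star (M k j)‖ ≤ t)} := by
    ext M; simp [testBox]
  rw [h]
  refine MeasurableSet.iInter fun j => MeasurableSet.iInter fun k => ?_
  have hre : Measurable fun M : Fin N → Fin N → ℂ => (M j k).re := by fun_prop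
  have him : Measurable fun M : Fin N → Fin N → ℂ => (M j k).im := by fun_prop
  refine MeasurableSet.inter (MeasurableSet.imp (MeasurableSet.const _) ?_)
    (MeasurableSet.inter (MeasurableSet.imp (MeasurableSet.const _) ?_)
      (MeasurableSet.imp (MeasurableSet.const _) ?_))
  · exact (hre measurableSet_Icc).inter (him measurableSet_Icc)
  · exact (hre measurableSet_Icc).inter (him measurableSet_Icc)
  · exact measurableSet_le (by fun_prop) measurable_const

/-- Fubini with the entries on and above the diagonal fixed: each lower entry then ranges over a
disc of radius `t` centred at `-star` of its mirror entry. -/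
theorem volume_testBox (t : ℝ) : volume (testBox N t)
    = volume (Metric.closedBall (0 : ℂ) t) ^ Fintype.card {p : Fin N × Fin N // p.2 < p.1} *
      ∏ p : {p : Fin N × Fin N // ¬ p.2 < p.1}, volume (upperEntry N t p) := by
  have hmp := (volume_preserving_piEquivPiSubtypeProd (fun _ : Fin N × Fin N => ℂ)
    (fun p => p.2 < p.1)).symm
  have hmc := (measurePreserving_uncurry (N := N)).symm
  rw [← hmc.measure_preimage_equiv, ← hmp.measure_preimage_equiv, Measure.volume_eq_prod,
    Measure.prod_apply_symm ((MeasurableEquiv.measurable _) ((MeasurableEquiv.measurable _)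
      (measurableSet_testBox t)))]
  have hslice : ∀ b : {p : Fin N × Fin N // ¬ p.2 < p.1} → ℂ,
      volume ((fun a => (a, b)) ⁻¹' ((MeasurableEquiv.piEquivPiSubtypeProd
        (fun _ : Fin N × Fin N => ℂ) (fun p => p.2 < p.1)).symm ⁻¹'
        ((MeasurableEquiv.curry (Fin N) (Fin N) ℂ).symm.symm ⁻¹' testBox N t)))
      = (Set.univ.pi fun p : {p : Fin N × Fin N // ¬ p.2 < p.1} => upperEntry N t p).indicator
        (fun _ => volume (Metric.closedBall (0 : ℂ) t) ^
          Fintype.card {p : Fin N × Fin N // p.2 < p.1}) b := by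
    intro b
    have hval : ∀ (a : {p : Fin N × Fin N // p.2 < p.1} → ℂ) (j k : Fin N),
        (MeasurableEquiv.curry (Fin N) (Fin N) ℂ).symm.symm ((MeasurableEquiv.piEquivPiSubtypeProd
          (fun _ : Fin N × Fin N => ℂ) (fun p => p.2 < p.1)).symm (a, b)) j k
        = if h : k < j then a ⟨(j, k), h⟩ else b ⟨(j, k), h⟩ := fun a j k => rfl
    have hup : (∀ j k : Fin N, (j = k → (if h : k < j then 0 else b ⟨(j, k), h⟩).re ∈ Set.Icc 0 t ∧
          (if h : k < j then 0 else b ⟨(j, k), h⟩).im ∈ Set.Icc (-t) t) ∧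
        (j < k → (if h : k < j then 0 else b ⟨(j, k), h⟩).re ∈ Set.Icc (-t) t ∧
          (if h : k < j then 0 else b ⟨(j, k), h⟩).im ∈ Set.Icc (-t) t)) ↔
        b ∈ Set.univ.pi fun p : {p : Fin N × Fin N // ¬ p.2 < p.1} => upperEntry N t p := by
      constructor
      · rintro h ⟨⟨j, k⟩, hjk⟩ -
        have hjk' : ¬ k < j := hjk
        obtain ⟨h1, h2⟩ := h j k
        simp only [dif_neg hjk'] at h1 h2
        rcases (not_lt.1 hjk').lt_or_eq with hlt | heq
        · simpa [upperEntry, hlt.ne] using h2 hlt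
        · simpa [upperEntry, heq] using h1 heq
      · intro h j k
        constructor
        · rintro rfl
          have := h ⟨(j, j), lt_irrefl _⟩ trivial
          simpa [upperEntry] using this
        · intro hlt
          have := h ⟨(j, k), hlt.not_gt⟩ trivial
          simpa [upperEntry, hlt.ne, hlt.not_gt] using this
    by_cases hb : b ∈ Set.univ.pi fun p : {p : Fin N × Fin N // ¬ p.2 < p.1} => upperEntry N t p
    · rw [Set.indicator_of_mem hb]
      have hset : ((fun a => (a, b)) ⁻¹' ((MeasurableEquiv.piEquivPiSubtypeProd
          (fun _ : Fin N × Fin N => ℂ) (fun p => p.2 < p.1)).symm ⁻¹'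
          ((MeasurableEquiv.curry (Fin N) (Fin N) ℂ).symm.symm ⁻¹' testBox N t)))
          = Set.univ.pi fun p : {p : Fin N × Fin N // p.2 < p.1} =>
            Metric.closedBall (-star (b ⟨(p.1.2, p.1.1), not_lt.2 p.2.le⟩)) t := by
        ext a
        simp only [Set.mem_preimage, testBox, Set.mem_ofPred_eq, hval]
        constructor
        · rintro h ⟨⟨j, k⟩, hjk⟩ -
          have hjk' : k < j := hjk
          have := (h j k).2.2 hjk
          rw [dif_pos hjk', dif_neg hjk'.not_gt] at this
          rw [mem_closedBall_iff_norm, sub_neg_eq_add]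
          exact this
        · intro h j k
          have h' := hup.2 hb j k
          refine ⟨fun hjk => ?_, fun hjk => ?_, fun hjk => ?_⟩
          · subst hjk
            simpa using h'.1 rfl
          · have := h'.2 hjk
            simpa [hjk.not_gt] using this
          · have := h ⟨(j, k), hjk⟩ trivial
            rw [mem_closedBall_iff_norm, sub_neg_eq_add] at this
            rw [dif_pos hjk, dif_neg hjk.not_gt]
            exact this
      rw [hset, volume_pi_pi]
      simp only [Measure.addHaar_closedBall_center (volume : Measure ℂ), Finset.prod_const,
        Finset.card_univ]
    · rw [Set.indicator_of_notMem hb]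
      convert measure_empty (μ := (volume : Measure ({p : Fin N × Fin N // p.2 < p.1} → ℂ)))
      ext a
      simp only [Set.mem_preimage, testBox, Set.mem_ofPred_eq, hval, Set.mem_empty_iff_false,
        iff_false]
      intro h
      refine hb (hup.1 fun j k => ⟨fun hjk => ?_, fun hjk => ?_⟩)
      · subst hjk
        simpa using (h j j).1 rfl
      · have := (h j k).2.1 hjk
        simpa [hjk.not_gt] using this
  simp_rw [hslice]
  have hm : MeasurableSet (Set.univ.pi fun p : {p : Fin N × Fin N // ¬ p.2 < p.1} =>
      upperEntry N t p) := by
    refine MeasurableSet.univ_pi fun p => ?_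
    exact (Complex.measurable_re measurableSet_Icc).inter (Complex.measurable_im measurableSet_Icc)
  rw [lintegral_indicator hm, setLIntegral_const, volume_pi_pi]

end TestBox

/-! ### Comparison of volumes and the value of the constant. -/

section Constant

open Filter Topology

variable {N : ℕ}

theorem card_lower_pairs (N : ℕ) :
    Fintype.card {p : Fin N × Fin N // p.2 < p.1} = ∑ k ∈ Finset.range N, k := by
  rw [Fintype.card_subtype, Finset.card_filter, Fintype.sum_prod_type, ← Fin.sum_univ_eq_sum_range]
  refine Finset.sum_congr rfl fun j _ => ?_
  rw [← Finset.card_filter, show Finset.univ.filter (fun k => k < j) = Finset.Iio j by ext; simp,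
    Fin.card_Iio]

theorem prod_lower_pairs_swap (b : ℝ) :
    ∏ p : Fin N × Fin N, (if p.2 < p.1 then b else 1)
      = ∏ p : Fin N × Fin N, (if p.1 < p.2 then b else 1) :=
  Fintype.prod_equiv (Equiv.prodComm _ _) _ _ fun _ => rfl

theorem pow_card_lower_pairs (b : ℝ) :
    b ^ Fintype.card {p : Fin N × Fin N // p.2 < p.1}
      = ∏ p : Fin N × Fin N, (if p.2 < p.1 then b else 1) := by
  rw [Finset.prod_ite, Finset.prod_const, Finset.prod_const_one, mul_one, Fintype.card_subtype]

theorem prod_diagonal_pairs (b : ℝ) :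
    ∏ p : Fin N × Fin N, (if p.1 = p.2 then b else 1) = b ^ N := by
  rw [Fintype.prod_prod_type]
  simp

/-- Each pair above the diagonal contributes `(2t)²` to the entries and `(2√2 t)²` to the
coordinates, hence one factor `2` per pair. A diagonal entry contributes `t · 2t`, one `t` more than
its coordinate. -/
theorem prod_upper_mul_two_pow (t : ℝ) :
    (∏ p : {p : Fin N × Fin N // ¬ p.2 < p.1},
        (t - if p.1.1 = p.1.2 then 0 else -t) * (t - -t)) *
        2 ^ Fintype.card {p : Fin N × Fin N // p.2 < p.1}
      = (∏ p : Fin N × Fin N, 2 * (if p.1 = p.2 then t else Real.sqrt 2 * t)) * t ^ N := by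
  have h1 : (∏ p : {p : Fin N × Fin N // ¬ p.2 < p.1},
        (t - if p.1.1 = p.1.2 then 0 else -t) * (t - -t))
      = ∏ p : Fin N × Fin N, if ¬ p.2 < p.1 then
        (t - if p.1 = p.2 then 0 else -t) * (t - -t) else 1 := by
    rw [← Finset.prod_filter]
    exact (Finset.prod_subtype (Finset.univ.filter fun p : Fin N × Fin N => ¬ p.2 < p.1)
      (fun p => by rw [Finset.mem_filter]; exact and_iff_right (Finset.mem_univ p))
      (fun p => (t - if p.1 = p.2 then 0 else -t) * (t - -t))).symm
  have h2 : (∏ p : Fin N × Fin N, 2 * (if p.1 = p.2 then t else Real.sqrt 2 * t))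
      = (∏ p : Fin N × Fin N, if ¬ p.2 < p.1 then
          2 * (if p.1 = p.2 then t else Real.sqrt 2 * t) else 1) *
        ∏ p : Fin N × Fin N, if p.2 < p.1 then 2 * (Real.sqrt 2 * t) else 1 := by
    rw [← Finset.prod_mul_distrib]
    refine Finset.prod_congr rfl fun p _ => ?_
    by_cases h : p.2 < p.1
    · simp [h, h.ne']
    · simp [h]
  have h3 : Real.sqrt 2 * Real.sqrt 2 = 2 := Real.mul_self_sqrt two_pos.le
  -- Products over lower pairs are moved to upper pairs, so that the identity can be checked factor
  -- by factor.
  rw [h1, h2, pow_card_lower_pairs, prod_lower_pairs_swap, prod_lower_pairs_swap,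
    ← prod_diagonal_pairs, ← Finset.prod_mul_distrib, ← Finset.prod_mul_distrib,
    ← Finset.prod_mul_distrib]
  refine Finset.prod_congr rfl fun p _ => ?_
  rcases lt_trichotomy p.1 p.2 with h | h | h
  · simp only [h, h.ne, h.not_gt, not_false_iff, if_true, if_false]
    linear_combination -4 * t * t * h3
  · simp [h]; ring
  · simp [h, h.ne', h.not_gt]

theorem volume_coordBox {t : ℝ} (ht : 0 ≤ t) : volume (coordBox N t)
    = ENNReal.ofReal (∏ p : Fin N × Fin N, 2 * (if p.1 = p.2 then t else Real.sqrt 2 * t)) := by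
  rw [coordBox, volume_pi_pi, ENNReal.ofReal_prod_of_nonneg]
  · refine Finset.prod_congr rfl fun p _ => ?_
    rw [Real.volume_Icc, sub_neg_eq_add, two_mul]
  · intro p _
    split_ifs <;> positivity

theorem volume_testBox_mul_two_pow {t : ℝ} (ht : 0 ≤ t) :
    volume (testBox N t) * 2 ^ Fintype.card {p : Fin N × Fin N // p.2 < p.1}
      = volume (coordBox N t) * ENNReal.ofReal (t ^ N) * volume (Metric.closedBall (0 : ℂ) t) ^
        Fintype.card {p : Fin N × Fin N // p.2 < p.1} := by
  have h1 : ∏ p : {p : Fin N × Fin N // ¬ p.2 < p.1}, volume (upperEntry N t p)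
      = ENNReal.ofReal (∏ p : {p : Fin N × Fin N // ¬ p.2 < p.1},
        (t - if p.1.1 = p.1.2 then 0 else -t) * (t - -t)) := by
    rw [ENNReal.ofReal_prod_of_nonneg]
    · refine Finset.prod_congr rfl fun p _ => ?_
      rw [upperEntry, volume_reIm_rect, ENNReal.ofReal_mul]
      split_ifs <;> linarith
    · intro p _
      apply mul_nonneg
      · split_ifs <;> linarith
      · linarith
  have h2 : (2 : ℝ≥0∞) = ENNReal.ofReal 2 := by simp
  rw [volume_testBox, h1, volume_coordBox ht, ← ENNReal.ofReal_mul, ← prod_upper_mul_two_pow,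
    ENNReal.ofReal_mul', h2, ENNReal.ofReal_pow]
  · ring
  · positivity
  · positivity
  · exact Finset.prod_nonneg fun p _ => by split_ifs <;> positivity

theorem prod_sliceVol {t : ℝ} (ht : 0 ≤ t) : ∏ k ∈ Finset.range N, sliceVol N t k
    = volume (Metric.closedBall (0 : ℂ) t) ^ Fintype.card {p : Fin N × Fin N // p.2 < p.1} *
      ENNReal.ofReal (∏ k ∈ Finset.range N,
        ((1 + t) ^ (2 * (N - k)) - 1) * (Real.pi ^ (N - k) / (N - k).factorial)) := by
  rw [card_lower_pairs, ENNReal.ofReal_prod_of_nonneg, ← Finset.prod_pow_eq_pow_sum,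
    ← Finset.prod_mul_distrib]
  · rfl
  · intro k _
    have : 1 ≤ (1 + t) ^ (2 * (N - k)) := one_le_pow₀ (by linarith)
    have : 0 ≤ (1 + t) ^ (2 * (N - k)) - 1 := by linarith
    positivity

theorem tendsto_shell_ratio (m : ℕ) :
    Tendsto (fun t : ℝ => ((1 + t) ^ (2 * m) - 1) / t) (𝓝[>] 0) (𝓝 (2 * m)) := by
  have h : HasDerivAt (fun t : ℝ => (1 + t) ^ (2 * m)) (2 * m) 0 := by
    have := ((hasDerivAt_id (0 : ℝ)).const_add 1).fun_pow (2 * m)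
    simpa using this
  have h' := h.tendsto_slope_zero_right
  refine h'.congr fun t => ?_
  simp [div_eq_inv_mul]

/-- With `m + 1 = N - k`, the factors match one by one: `m!/(2π)^(m+1) · 2^m · 2(m+1) ·
π^(m+1)/(m+1)! = 1`. -/
theorem constC_mul_eq_one (hN : 1 ≤ N) :
    constC N * (2 ^ Fintype.card {p : Fin N × Fin N // p.2 < p.1} * ∏ k ∈ Finset.range N,
      (2 * ((N - k : ℕ) : ℝ)) * (Real.pi ^ (N - k) / (N - k).factorial)) = 1 := by
  have h1 : constC N = ∏ m ∈ Finset.range N, (m.factorial : ℝ) / (2 * Real.pi) ^ (m + 1) := by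
    have e1 : ∏ j ∈ Finset.Icc 1 (N - 1), (j.factorial : ℝ) = ∏ j ∈ Finset.range N, (j.factorial : ℝ) := by
      refine Finset.prod_subset (fun j hj => ?_) fun j hj hj' => ?_
      · rw [Finset.mem_Icc] at hj
        rw [Finset.mem_range]
        omega
      · rw [Finset.mem_range] at hj
        rw [Finset.mem_Icc] at hj'
        have : j = 0 := by omega
        simp [this]
    have e2 : N * (N + 1) / 2 = ∑ m ∈ Finset.range N, (m + 1) := by
      have := Finset.sum_range_succ' (fun m => m) N
      rw [Finset.sum_range_id] at this
      simp only [add_tsub_cancel_right, add_zero] at this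
      rw [← this, mul_comm]
    rw [constC, e1, e2, ← Finset.prod_pow_eq_pow_sum, Finset.prod_div_distrib]
  rw [h1, card_lower_pairs, ← Finset.prod_pow_eq_pow_sum, ← Finset.prod_range_reflect (fun k =>
    (2 * ((N - k : ℕ) : ℝ)) * (Real.pi ^ (N - k) / (N - k).factorial)), ← Finset.prod_mul_distrib,
    ← Finset.prod_mul_distrib]
  refine Finset.prod_eq_one fun m hm => ?_
  have hm' : N - (N - 1 - m) = m + 1 := by
    have := Finset.mem_range.1 hm
    omega
  rw [hm', Nat.factorial_succ]
  have hpi := Real.pi_pos.ne'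
  have hf : (m.factorial : ℝ) ≠ 0 := by exact_mod_cast m.factorial_ne_zero
  push_cast
  rw [mul_pow]
  field_simp
  ring

theorem norm_le_of_mem_coordBox {t : ℝ} (ht : 0 ≤ t) {x : Fin N × Fin N → ℝ}
    (hx : x ∈ coordBox N t) : ‖WithLp.toLp 2 x‖ ≤ 2 * N * t := by
  have h3 : Real.sqrt 2 ^ 2 = 2 := Real.sq_sqrt two_pos.le
  have h1 : ∀ p, x p ^ 2 ≤ 2 * t ^ 2 := fun p => by
    have := hx p trivial
    have h4 : x p ^ 2 ≤ (if p.1 = p.2 then t else Real.sqrt 2 * t) ^ 2 := sq_le_sq' this.1 this.2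
    refine h4.trans ?_
    split_ifs
    · nlinarith
    · rw [mul_pow, h3]
  rw [EuclideanSpace.norm_eq]
  apply Real.sqrt_le_iff.2 ⟨by positivity, ?_⟩
  calc ∑ p : Fin N × Fin N, ‖x p‖ ^ 2 ≤ ∑ _p : Fin N × Fin N, 2 * t ^ 2 :=
        Finset.sum_le_sum fun p _ => by rw [Real.norm_eq_abs, sq_abs]; exact h1 p
    _ = 2 * (N * t) ^ 2 := by simp; ring
    _ ≤ _ := by nlinarith [sq_nonneg (N * t)]

/-- The image of `testBox` under `triExp` is `triSet` of the chart image of the box, whose volume is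
a Haar measure times disc and shell volumes. The number of discs is the same as in `volume_testBox`,
so they cancel. -/
theorem eventually_haarU_coordBox {m m' : ℝ≥0} (hm : m < 1) (hm' : 1 < m') :
    ∀ᶠ t : ℝ in 𝓝[>] 0,
      m * (volume (coordBox N t) * ENNReal.ofReal (t ^ N)) ≤ haarU N (expChart '' coordBox N t) *
        (2 ^ Fintype.card {p : Fin N × Fin N // p.2 < p.1} * ENNReal.ofReal (∏ k ∈ Finset.range N,
          ((1 + t) ^ (2 * (N - k)) - 1) * (Real.pi ^ (N - k) / (N - k).factorial))) ∧
      haarU N (expChart '' coordBox N t) *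
        (2 ^ Fintype.card {p : Fin N × Fin N // p.2 < p.1} * ENNReal.ofReal (∏ k ∈ Finset.range N,
          ((1 + t) ^ (2 * (N - k)) - 1) * (Real.pi ^ (N - k) / (N - k).factorial)))
        ≤ m' * (volume (coordBox N t) * ENNReal.ofReal (t ^ N)) := by
  obtain ⟨s₀, hs₀, h⟩ := exists_nhds_volume_image_triExp (N := N) hm hm'
  obtain ⟨η, hη, hball⟩ := Metric.mem_nhds_iff.1 hs₀
  have hsmall : ∀ᶠ t : ℝ in 𝓝[>] 0, 3 * t < η := by
    have : Tendsto (fun t : ℝ => 3 * t) (𝓝[>] 0) (𝓝 (3 * 0)) :=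
      ((continuous_const_mul (3 : ℝ)).tendsto 0).mono_left nhdsWithin_le_nhds
    rw [mul_zero] at this
    exact this.eventually (gt_mem_nhds hη)
  filter_upwards [hsmall, self_mem_nhdsWithin] with t ht ht0
  have ht0' : (0 : ℝ) < t := ht0
  have hsub : testBox N t ⊆ s₀ := by
    intro M hM
    apply hball
    rw [mem_ball_zero_iff]
    refine lt_of_le_of_lt ?_ ht
    refine (pi_norm_le_iff_of_nonneg (by positivity)).2 fun j =>
      (pi_norm_le_iff_of_nonneg (by positivity)).2 fun k => norm_le_of_mem_testBox hM j k
  have hcl : IsClosed (expChart '' coordBox N t) :=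
    ((isCompact_univ_pi fun _ => isCompact_Icc).image continuous_expChart).isClosed
  obtain ⟨h1, h2⟩ := h _ hsub
  rw [image_triExp_testBox, volume_triSet t hcl, triSet_univ, volume_triFrames ht0'.le,
    prod_sliceVol ht0'.le] at h1 h2
  -- Multiplying by `2 ^ n` rewrites the volume of the test set through that of the coordinate box;
  -- `D` collects the discs to be cancelled.
  have hvol := volume_testBox_mul_two_pow (N := N) ht0'.le
  set n := Fintype.card {p : Fin N × Fin N // p.2 < p.1}
  set D := volume (Metric.closedBall (0 : ℂ) t) ^ n with hD
  have hD0 : D ≠ 0 := pow_ne_zero _ (Metric.measure_closedBall_pos _ _ ht0').ne'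
  have hDt : D ≠ ⊤ := ENNReal.pow_ne_top (isCompact_closedBall _ _).measure_lt_top.ne
  constructor
  · rw [← ENNReal.mul_le_mul_iff_left hD0 hDt]
    calc _ = m * (volume (testBox N t) * 2 ^ n) := by rw [hvol]; ring
      _ = m * volume (testBox N t) * 2 ^ n := by ring
      _ ≤ _ := mul_le_mul_left h1 _
      _ = _ := by ring
  · rw [← ENNReal.mul_le_mul_iff_left hD0 hDt]
    calc _ = (haarU N (expChart '' coordBox N t) * (D * ENNReal.ofReal (∏ k ∈ Finset.range N,
          ((1 + t) ^ (2 * (N - k)) - 1) * (Real.pi ^ (N - k) / (N - k).factorial)))) * 2 ^ n := by ring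
      _ ≤ _ := mul_le_mul_left h2 _
      _ = m' * (volume (testBox N t) * 2 ^ n) := by ring
      _ = _ := by rw [hvol]; ring

end Constant

/-! ### Identification of the density constant. -/

section DensityConstant

open Filter Topology

variable {N : ℕ}

theorem volume_coordBox_ne_zero {t : ℝ} (ht : 0 < t) : volume (coordBox N t) ≠ 0 := by
  rw [volume_coordBox ht.le, ne_eq, ENNReal.ofReal_eq_zero, not_le]
  exact Finset.prod_pos fun p _ => by split_ifs <;> positivity

/-- The product of the volumes of the shells, rescaled by `t ^ N`. -/
theorem tendsto_prod_shell_ratio (N : ℕ) :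
    Tendsto (fun t : ℝ => (∏ k ∈ Finset.range N,
        ((1 + t) ^ (2 * (N - k)) - 1) * (Real.pi ^ (N - k) / (N - k).factorial)) / t ^ N) (𝓝[>] 0)
      (𝓝 (∏ k ∈ Finset.range N,
        (2 * ((N - k : ℕ) : ℝ)) * (Real.pi ^ (N - k) / (N - k).factorial))) := by
  have h : Tendsto (fun t : ℝ => ∏ k ∈ Finset.range N,
        (((1 + t) ^ (2 * (N - k)) - 1) / t) * (Real.pi ^ (N - k) / (N - k).factorial)) (𝓝[>] 0)
      (𝓝 (∏ k ∈ Finset.range N,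
        (2 * ((N - k : ℕ) : ℝ)) * (Real.pi ^ (N - k) / (N - k).factorial))) :=
    tendsto_finsetProd _ fun k _ => (tendsto_shell_ratio (N - k)).mul_const _
  refine h.congr fun t => ?_
  rw [show t ^ N = ∏ _k ∈ Finset.range N, t by simp, ← Finset.prod_div_distrib]
  exact Finset.prod_congr rfl fun k _ => by ring

/-- The density bounds on the shrinking box, with `ρ = 2Nt`, are compared with
`eventually_haarU_coordBox`. Dividing by the box volume and `t^N` and letting `t → 0` gives `m ≤ c ·
2^n K ≤ m'` for all `m < 1 < m'`, so `c · 2^n K = 1`, the equation that `constC` satisfies. -/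
theorem density_eq_constC (hN : 1 ≤ N) {c : ℝ≥0∞} (hct : c ≠ ⊤)
    (hc : ∀ (A : Set (Fin N × Fin N → ℝ)) (ρ : ℝ), ρ ≤ 1 / 4 → (∀ x ∈ A, ‖WithLp.toLp 2 x‖ ≤ ρ) →
      ENNReal.ofReal (2 - Real.exp ρ) ^ (N ^ 2) * c * volume A ≤ haarU N (expChart '' A) ∧
      haarU N (expChart '' A) ≤ ENNReal.ofReal (Real.exp ρ) ^ (N ^ 2) * c * volume A) :
    c = ENNReal.ofReal (constC N) := by
  obtain ⟨g, rfl⟩ : ∃ g : ℝ≥0, c = g := ⟨c.toNNReal, (ENNReal.coe_toNNReal hct).symm⟩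
  set n := Fintype.card {p : Fin N × Fin N // p.2 < p.1} with hn
  set P : ℝ → ℝ := fun t => ∏ k ∈ Finset.range N,
    ((1 + t) ^ (2 * (N - k)) - 1) * (Real.pi ^ (N - k) / (N - k).factorial) with hP
  set K : ℝ := ∏ k ∈ Finset.range N,
    (2 * ((N - k : ℕ) : ℝ)) * (Real.pi ^ (N - k) / (N - k).factorial) with hK
  have hlim0 : Tendsto (fun t : ℝ => 2 * N * t) (𝓝[>] 0) (𝓝 0) := by
    have : Tendsto (fun t : ℝ => 2 * N * t) (𝓝[>] 0) (𝓝 (2 * N * 0)) :=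
      ((continuous_const_mul (2 * N : ℝ)).tendsto 0).mono_left nhdsWithin_le_nhds
    rwa [mul_zero] at this
  have hexp : Tendsto (fun t : ℝ => Real.exp (2 * N * t)) (𝓝[>] 0) (𝓝 1) := by
    have := (Real.continuous_exp.tendsto 0).comp hlim0
    rwa [Real.exp_zero] at this
  have hsmall : ∀ᶠ t : ℝ in 𝓝[>] 0, 2 * N * t ≤ 1 / 4 :=
    (hlim0.eventually (gt_mem_nhds (show (0 : ℝ) < 1 / 4 by norm_num))).mono fun t h => h.le
  have hPnonneg : ∀ t : ℝ, 0 < t → 0 ≤ P t := fun t ht => Finset.prod_nonneg fun k _ => by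
    have : 1 ≤ (1 + t) ^ (2 * (N - k)) := one_le_pow₀ (by linarith)
    have : 0 ≤ (1 + t) ^ (2 * (N - k)) - 1 := by linarith
    positivity
  have hof : ∀ a : ℝ≥0, (a : ℝ≥0∞) = ENNReal.ofReal a := fun a => (ENNReal.ofReal_coe_nnreal).symm
  have h2 : (2 : ℝ≥0∞) = ENNReal.ofReal 2 := by simp
  have hlow : ∀ m : ℝ≥0, m < 1 → (m : ℝ) ≤ g * (2 ^ n * K) := by
    intro m hm
    have hT : Tendsto (fun t : ℝ => Real.exp (2 * N * t) ^ (N ^ 2) * (g * (2 ^ n * (P t / t ^ N))))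
        (𝓝[>] 0) (𝓝 (1 ^ (N ^ 2) * (g * (2 ^ n * K)))) :=
      (hexp.pow _).mul (((tendsto_prod_shell_ratio N).const_mul _).const_mul _)
    rw [one_pow, one_mul] at hT
    refine ge_of_tendsto hT ?_
    -- Only the lower half is used, so any upper constant above `1` serves; `2` is arbitrary.
    filter_upwards [eventually_haarU_coordBox (N := N) hm (show (1 : ℝ≥0) < 2 by norm_num), hsmall,
      self_mem_nhdsWithin] with t h ht ht0
    have ht0' : (0 : ℝ) < t := ht0
    have hb := (hc _ _ ht fun x hx => norm_le_of_mem_coordBox ht0'.le hx).2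
    have h3 := h.1.trans (mul_le_mul_left hb _)
    have hv0 := volume_coordBox_ne_zero (N := N) ht0'
    have hvt : volume (coordBox N t) ≠ ⊤ := by
      rw [volume_coordBox ht0'.le]; exact ENNReal.ofReal_ne_top
    have h4 : (m : ℝ≥0∞) * ENNReal.ofReal (t ^ N)
        ≤ ENNReal.ofReal (Real.exp (2 * N * t)) ^ (N ^ 2) * (g * (2 ^ n * ENNReal.ofReal (P t))) := by
      rw [← ENNReal.mul_le_mul_iff_left hv0 hvt]
      calc _ = m * (volume (coordBox N t) * ENNReal.ofReal (t ^ N)) := by ring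
        _ ≤ _ := h3
        _ = _ := by ring
    rw [hof, hof, h2, ← ENNReal.ofReal_pow (by positivity), ← ENNReal.ofReal_pow (by positivity),
      ← ENNReal.ofReal_mul (by positivity), ← ENNReal.ofReal_mul (by positivity),
      ← ENNReal.ofReal_mul (by positivity), ← ENNReal.ofReal_mul (by positivity),
      ENNReal.ofReal_le_ofReal_iff (by have := hPnonneg t ht0'; positivity)] at h4
    rw [← mul_le_mul_iff_left₀ (pow_pos ht0' N)]
    refine h4.trans (le_of_eq ?_)
    field_simp
  have hup : ∀ m : ℝ≥0, 1 < m → g * (2 ^ n * K) ≤ (m : ℝ) := by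
    intro m hm
    have hT : Tendsto (fun t : ℝ => (2 - Real.exp (2 * N * t)) ^ (N ^ 2) *
        (g * (2 ^ n * (P t / t ^ N)))) (𝓝[>] 0) (𝓝 ((2 - 1) ^ (N ^ 2) * (g * (2 ^ n * K)))) :=
      ((hexp.const_sub 2).pow _).mul (((tendsto_prod_shell_ratio N).const_mul _).const_mul _)
    rw [show (2 : ℝ) - 1 = 1 by norm_num, one_pow, one_mul] at hT
    refine le_of_tendsto hT ?_
    filter_upwards [eventually_haarU_coordBox (N := N) (show (0 : ℝ≥0) < 1 by norm_num) hm, hsmall,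
      self_mem_nhdsWithin] with t h ht ht0
    have ht0' : (0 : ℝ) < t := ht0
    have hb := (hc _ _ ht fun x hx => norm_le_of_mem_coordBox ht0'.le hx).1
    have h3 := (mul_le_mul_left hb _).trans h.2
    have hv0 := volume_coordBox_ne_zero (N := N) ht0'
    have hvt : volume (coordBox N t) ≠ ⊤ := by
      rw [volume_coordBox ht0'.le]; exact ENNReal.ofReal_ne_top
    have hpos : 0 ≤ 2 - Real.exp (2 * N * t) := by
      have := (Real.exp_le_exp.2 ht).trans_lt exp_quarter_lt_two
      linarith
    have h4 : ENNReal.ofReal (2 - Real.exp (2 * N * t)) ^ (N ^ 2) *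
        (g * (2 ^ n * ENNReal.ofReal (P t))) ≤ (m : ℝ≥0∞) * ENNReal.ofReal (t ^ N) := by
      rw [← ENNReal.mul_le_mul_iff_left hv0 hvt]
      calc _ = _ := by ring
        _ ≤ _ := h3
        _ = _ := by ring
    rw [hof, hof, h2, ← ENNReal.ofReal_pow (by positivity), ← ENNReal.ofReal_pow (by positivity),
      ← ENNReal.ofReal_mul (by positivity), ← ENNReal.ofReal_mul (by positivity),
      ← ENNReal.ofReal_mul (by positivity), ← ENNReal.ofReal_mul (by positivity),
      ENNReal.ofReal_le_ofReal_iff (by positivity)] at h4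
    rw [← mul_le_mul_iff_left₀ (pow_pos ht0' N)]
    refine le_trans (le_of_eq ?_) h4
    field_simp
  have hone : (g : ℝ) * (2 ^ n * K) = 1 := by
    apply le_antisymm
    · refine le_of_forall_gt_imp_ge_of_dense fun a ha => ?_
      lift a to ℝ≥0 using by linarith
      exact hup a (by exact_mod_cast ha)
    · refine le_of_forall_lt_imp_le_of_dense fun a ha => ?_
      rcases le_or_gt 0 a with h0 | h0
      · lift a to ℝ≥0 using h0
        exact hlow a (by exact_mod_cast ha)
      · refine h0.le.trans ?_
        have := hlow 0 (by norm_num)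
        simpa using this
  have hC := constC_mul_eq_one hN
  rw [hof]
  congr 1
  have hne : 2 ^ n * K ≠ 0 := right_ne_zero_of_mul (hone ▸ one_ne_zero)
  exact mul_right_cancel₀ hne (hone.trans hC.symm)

end DensityConstant

/-! ### Monotonicity and scaling of product measures. -/

section ProductMeasures

/-- The outer measure defining the product is the largest one bounded on boxes by the products of
side measures. `Measure.pi μ` meets this bound for `ν`, since its values on boxes are known exactly.
-/
theorem measure_pi_mono {ι : Type*} [Fintype ι] {α : ι → Type*} [∀ i, MeasurableSpace (α i)]
    {μ ν : ∀ i, Measure (α i)} [∀ i, SigmaFinite (μ i)] (h : ∀ i, μ i ≤ ν i) :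
    Measure.pi μ ≤ Measure.pi ν := by
  have hle : (Measure.pi μ).toOuterMeasure ≤ OuterMeasure.pi fun i => (ν i).toOuterMeasure := by
    refine OuterMeasure.le_pi.2 fun s _ => ?_
    change Measure.pi μ (Set.univ.pi s) ≤ _
    rw [Measure.pi_pi]
    exact Finset.prod_le_prod' fun i _ => h i (s i)
  refine Measure.le_iff.2 fun s hs => ?_
  conv_rhs => rw [Measure.pi, toMeasure_apply _ _ hs]
  exact hle s

theorem measure_pi_const_smul {ι : Type*} [Fintype ι] {α : Type*} [MeasurableSpace α]
    (a : ℝ≥0) (μ : Measure α) [IsFiniteMeasure μ] :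
    Measure.pi (fun _ : ι => a • μ) = (a ^ Fintype.card ι) • Measure.pi (fun _ : ι => μ) := by
  refine Measure.pi_eq fun s _ => ?_
  rw [Measure.smul_apply, Measure.pi_pi]
  simp only [Measure.smul_apply, ENNReal.smul_def, smul_eq_mul, Finset.prod_mul_distrib,
    Finset.prod_const, Finset.card_univ, ENNReal.coe_pow]

theorem lintegral_pi_map_restrict {ι α β : Type*} [Fintype ι] [MeasurableSpace α] [MeasurableSpace β]
    {μ : Measure α} [SigmaFinite μ] {s : Set α} [IsFiniteMeasure (μ.restrict s)] {g : α → β}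
    (hg : Measurable g) {f : (ι → β) → ℝ≥0∞} (hf : Measurable f) :
    ∫⁻ y, f y ∂(Measure.pi fun _ : ι => (μ.restrict s).map g)
      = ∫⁻ x in Set.univ.pi (fun _ : ι => s), f (fun i => g (x i)) ∂(Measure.pi fun _ : ι => μ) := by
  rw [Measure.restrict_pi_pi, ← Measure.pi_map_pi fun _ => hg.aemeasurable, lintegral_map hf]
  exact measurable_pi_lambda _ fun i => hg.comp (measurable_pi_apply i)

end ProductMeasures

/-! ### Comparison of the measures and the integral inequalities. -/

section Integration

variable {N : ℕ}

theorem constC_nonneg (N : ℕ) : 0 ≤ constC N := by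
  unfold constC
  have := Real.pi_pos
  positivity

theorem mem_ballH_hermOfCoords_iff {r : ℝ} {x : Fin N × Fin N → ℝ} :
    hermOfCoords x ∈ ballH 0 r ↔ ‖WithLp.toLp 2 x‖ ≤ r := by
  open scoped Matrix.Norms.Frobenius in
  have h : ‖(0 : Matrix (Fin N) (Fin N) ℂ) - (hermOfCoords x).1‖ = ‖WithLp.toLp 2 x‖ := by
    rw [zero_sub, norm_neg, norm_hermOfCoords]
  rw [← h]
  rfl

theorem measurableSet_ballH (r : ℝ) : MeasurableSet (ballH (0 : Herm N) r) := by
  open scoped Matrix.Norms.Frobenius in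
  have hc : Continuous fun G : Herm N => ‖(0 : Matrix (Fin N) (Fin N) ℂ) - G.1‖ :=
    (continuous_norm (E := Matrix (Fin N) (Fin N) ℂ)).comp
      (continuous_const.sub continuous_subtype_val)
  exact (isClosed_le hc continuous_const).measurableSet

theorem lebesgueH_apply {S : Set (Herm N)} (hS : MeasurableSet S) :
    lebesgueH N S = volume (hermOfCoords ⁻¹' S) :=
  Measure.map_apply (continuous_hermOfCoords N).measurable hS

theorem lebesgueH_ballH_lt_top (r : ℝ) : lebesgueH N (ballH 0 r) < ⊤ := by
  rw [lebesgueH_apply (measurableSet_ballH r)]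
  have : hermOfCoords ⁻¹' (ballH (0 : Herm N) r) ⊆ WithLp.toLp 2 ⁻¹'
      (Metric.closedBall (0 : EuclideanSpace ℝ (Fin N × Fin N)) r) := fun x hx => by
    rw [Set.mem_preimage, mem_closedBall_zero_iff]
    exact mem_ballH_hermOfCoords_iff.1 hx
  refine (measure_mono this).trans_lt ?_
  rw [(PiLp.volume_preserving_toLp (Fin N × Fin N)).measure_preimage
    Metric.isClosed_closedBall.measurableSet.nullMeasurableSet]
  exact (isCompact_closedBall _ _).measure_lt_top

instance (r : ℝ) : IsFiniteMeasure ((lebesgueH N).restrict (ballH 0 r)) :=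
  ⟨by rw [Measure.restrict_apply_univ]; exact lebesgueH_ballH_lt_top r⟩

instance : SigmaFinite (lebesgueH N) :=
  ⟨⟨{ set := fun n => ballH 0 n
      set_mem := fun _ => trivial
      finite := fun n => lebesgueH_ballH_lt_top n
      spanning := Set.iUnion_eq_univ_iff.2 fun G => exists_nat_ge (hsNorm ((0 : Herm N).1 - G.1)) }⟩⟩

/-- Comparison of Haar measure near the identity with the image of Lebesgue measure under the
exponential map. -/
theorem exists_haarU_restrict_bounds (hN : 1 ≤ N) : ∃ r₀ : ℝ, 0 < r₀ ∧ r₀ ≤ 1 / 24 ∧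
    ∀ r : ℝ, 0 < r → r ≤ r₀ →
      ((2 - Real.exp (6 * r)) ^ (N ^ 2) * constC N).toNNReal •
          ((lebesgueH N).restrict (ballH 0 r)).map expI ≤ (haarU N).restrict (ballU 1 (2 * r)) ∧
      (haarU N).restrict (ballU 1 (2 * r)) ≤ (Real.exp (6 * r * N ^ 2) * constC N).toNNReal •
          ((lebesgueH N).restrict (ballH 0 (3 * r))).map expI := by
  obtain ⟨c, -, hct, hc⟩ := exists_haarU_density N
  obtain rfl := density_eq_constC hN hct hc
  obtain ⟨η, hη, hsurj⟩ := exists_ballU_subset_expChart N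
  have hpull : ∀ (S : Set (UGroup N)), MeasurableSet S → ∀ r : ℝ,
      (((lebesgueH N).restrict (ballH 0 r)).map expI) S
        = volume {x : Fin N × Fin N → ℝ | expChart x ∈ S ∧ ‖WithLp.toLp 2 x‖ ≤ r} := by
    intro S hS r
    have hS' : MeasurableSet (expI ⁻¹' S : Set (Herm N)) := continuous_expI.measurable hS
    rw [Measure.map_apply continuous_expI.measurable hS, Measure.restrict_apply hS',
      lebesgueH_apply (hS'.inter (measurableSet_ballH r))]
    congr 1
    ext x
    exact and_congr Iff.rfl mem_ballH_hermOfCoords_iff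
  -- The bound `1/24` gives `6r ≤ 1/4`, which keeps `e^{6r} < 2` and puts the coordinate radii `r`
  -- and `3r` within reach of the density estimate.
  refine ⟨min η (1 / 24), by positivity, min_le_right _ _, fun r hr0 hr => ?_⟩
  have hr1 : r ≤ η := hr.trans (min_le_left _ _)
  have hr2 : r ≤ 1 / 24 := hr.trans (min_le_right _ _)
  constructor
  · refine Measure.le_iff.2 fun S hS => ?_
    rw [Measure.smul_apply, ENNReal.smul_def, smul_eq_mul, hpull S hS, Measure.restrict_apply hS]
    have h := (hc {x | expChart x ∈ S ∧ ‖WithLp.toLp 2 x‖ ≤ r} r (by linarith) fun x hx => hx.2).1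
    refine le_trans ?_ (h.trans (measure_mono ?_))
    · have h6 : Real.exp (6 * r) < 2 :=
        (Real.exp_le_exp.2 (by linarith)).trans_lt exp_quarter_lt_two
      -- The chart gives the sharper factor `2 - e^r`; passing to `6r` only loses.
      have h1 : Real.exp r ≤ Real.exp (6 * r) := Real.exp_le_exp.2 (by linarith)
      change ENNReal.ofReal _ * _ ≤ _
      rw [← ENNReal.ofReal_pow (by linarith), ← ENNReal.ofReal_mul (pow_nonneg (by linarith) _)]
      gcongr
      exact constC_nonneg N
    · rintro _ ⟨x, ⟨hxS, hx⟩, rfl⟩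
      exact ⟨hxS, expChart_mem_ballU (by linarith) hx⟩
  · refine Measure.le_iff.2 fun S hS => ?_
    rw [Measure.smul_apply, ENNReal.smul_def, smul_eq_mul, hpull S hS, Measure.restrict_apply hS]
    have h := (hc {x | expChart x ∈ S ∧ ‖WithLp.toLp 2 x‖ ≤ 3 * r} (3 * r) (by linarith)
      fun x hx => hx.2).2
    refine le_trans (measure_mono ?_) (h.trans ?_)
    · rintro U ⟨hUS, hU⟩
      obtain ⟨x, hx, rfl⟩ := hsurj r hr1 U hU
      exact ⟨x, ⟨hUS, hx⟩, rfl⟩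
    · change _ ≤ ENNReal.ofReal _ * _
      rw [← ENNReal.ofReal_pow (Real.exp_pos _).le, ← ENNReal.ofReal_mul (by positivity),
        ← Real.exp_nat_mul]
      -- Likewise the chart gives `e^{3r}` per dimension, which is weakened to `e^{6r}`.
      have hle : ((N ^ 2 : ℕ) : ℝ) * (3 * r) ≤ 6 * r * N ^ 2 := by
        push_cast
        nlinarith [sq_nonneg (N : ℝ)]
      have := constC_nonneg N
      exact mul_le_mul_left (ENNReal.ofReal_le_ofReal
        (mul_le_mul_of_nonneg_right (Real.exp_le_exp.2 hle) this)) _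

end Integration

end LieIntegration

end

theorem theorem10p1 (N : ℕ) (hN : 1 ≤ N) :
    ∃ r₀ : ℝ, 0 < r₀ ∧
      (∀ f : UGroup N → ℝ≥0, Measurable f → ∀ r : ℝ, 0 < r → r ≤ r₀ →
        ENNReal.ofReal ((2 - Real.exp (6 * r)) ^ (N ^ 2) * constC N) *
            ∫⁻ H in ballH 0 r, (f (expI H) : ℝ≥0∞) ∂(lebesgueH N)
          ≤ ∫⁻ U in ballU 1 (2 * r), (f U : ℝ≥0∞) ∂(haarU N) ∧
        ∫⁻ U in ballU 1 (2 * r), (f U : ℝ≥0∞) ∂(haarU N)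
          ≤ ENNReal.ofReal (Real.exp (6 * r * N ^ 2) * constC N) *
            ∫⁻ H in ballH 0 (3 * r), (f (expI H) : ℝ≥0∞) ∂(lebesgueH N)) ∧
      (∀ n : ℕ, 1 ≤ n → ∀ f : (Fin n → UGroup N) → ℝ≥0, Measurable f →
        ∀ r : ℝ, 0 < r → r ≤ r₀ →
        ENNReal.ofReal ((2 - Real.exp (6 * r)) ^ (N ^ 2 * n) * constC N ^ n) *
            ∫⁻ H in Set.univ.pi (fun _ : Fin n => ballH 0 r),
              (f (fun i => expI (H i)) : ℝ≥0∞) ∂(Measure.pi fun _ : Fin n => lebesgueH N)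
          ≤ ∫⁻ U in Set.univ.pi (fun _ : Fin n => ballU 1 (2 * r)),
              (f U : ℝ≥0∞) ∂(Measure.pi fun _ : Fin n => haarU N) ∧
        ∫⁻ U in Set.univ.pi (fun _ : Fin n => ballU 1 (2 * r)),
              (f U : ℝ≥0∞) ∂(Measure.pi fun _ : Fin n => haarU N)
          ≤ ENNReal.ofReal (Real.exp (6 * r * N ^ 2 * n) * constC N ^ n) *
            ∫⁻ H in Set.univ.pi (fun _ : Fin n => ballH 0 (3 * r)),
              (f (fun i => expI (H i)) : ℝ≥0∞) ∂(Measure.pi fun _ : Fin n => lebesgueH N)) := by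
  obtain ⟨r₀, hr₀, hr₁, hbounds⟩ := exists_haarU_restrict_bounds hN
  have hexp : Measurable (expI (N := N)) := continuous_expI.measurable
  refine ⟨r₀, hr₀, fun f hf r hr hrr => ?_, fun n _ f hf r hr hrr => ?_⟩
  · obtain ⟨hlow, hup⟩ := hbounds r hr hrr
    have hf' : Measurable fun U => (f U : ℝ≥0∞) := hf.coe_nnreal_ennreal
    have h1 := lintegral_mono' hlow (le_refl fun U => (f U : ℝ≥0∞))
    have h2 := lintegral_mono' hup (le_refl fun U => (f U : ℝ≥0∞))
    rw [lintegral_smul_measure, lintegral_map hf' hexp] at h1 h2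
    exact ⟨h1, h2⟩
  · obtain ⟨hlow, hup⟩ := hbounds r hr hrr
    have hf' : Measurable fun U => (f U : ℝ≥0∞) := hf.coe_nnreal_ennreal
    have h6 : Real.exp (6 * r) < 2 :=
      (Real.exp_le_exp.2 (by linarith)).trans_lt exp_quarter_lt_two
    -- The one-variable inequalities hold between measures, not merely between integrals, so they
    -- pass to the product at once, with the same `r₀` for every `n`.
    have h1 := lintegral_mono' (measure_pi_mono fun _ : Fin n => hlow)
      (le_refl fun U => (f U : ℝ≥0∞))
    have h2 := lintegral_mono' (measure_pi_mono fun _ : Fin n => hup)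
      (le_refl fun U => (f U : ℝ≥0∞))
    have hA : 0 ≤ (2 - Real.exp (6 * r)) ^ (N ^ 2) * constC N :=
      mul_nonneg (pow_nonneg (by linarith) _) (constC_nonneg N)
    have hB : 0 ≤ Real.exp (6 * r * N ^ 2) * constC N :=
      mul_nonneg (Real.exp_pos _).le (constC_nonneg N)
    rw [measure_pi_const_smul, lintegral_smul_measure, lintegral_pi_map_restrict hexp hf',
      Fintype.card_fin, ← Measure.restrict_pi_pi, ← Real.toNNReal_pow] at h1 h2
    · rw [mul_pow, ← pow_mul] at h1
      rw [mul_pow, ← Real.exp_nat_mul, mul_comm (n : ℝ)] at h2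
      exact ⟨h1, h2⟩
    · exact hB
    · exact hA
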